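/- Let $(R,\mathfrak m,k)$ be a Noetherian local ring and let $I$ be an ideal of $R$. For $n\in\mathbb N$ let $$I^{(n)}=\bigcap_{\mathfrak p\in \mathrm{Min}(I)}\bigl(I^nR_{\mathfrak p}\cap R\bigr)$$ be the $n$-th symbolic power of $I$, where $\mathrm{Min}(I)$ is the set of minimal primes of $I$, and let $\mathcal R^s(I)=\bigoplus_{n\in\mathbb N}I^{(n)}t^n\subseteq R[t]$ be the symbolic Rees algebra. Writing $\mu(\cdot)$ for the minimal number of generators, let $$s\ell(I)=\min\{t\in\mathbb R_{\ge 0}\mid \mu(I^{(n)})=O(n^{t-1})\text{ as }n\to\infty\}$$ be the symbolic analytic spread of $I$, and let $$\mathrm{ara}(I)=\min\{u\in\mathbb N\mid \text{there exist } g_1,\dots,g_u\in R\text{ with }\sqrt{(g_1,\dots,g_u)}=\sqrt I\}$$ be the arithmetic rank of $I$. Assume that $\operatorname{depth} R\ge \min\{\dim R/I,\,1\}$ and that the ring $\mathcal R^s(I)$ is Noetherian. Then the minimum defining $s\ell(I)$ exists, and $$\mathrm{ara}(I)\le s\ell(I)\le \max\{\dim R-\dim R/I,\ \dim R-1\}.$$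 (For $I=R$ we use the convention $\dim R/I=-\infty$.) -/

import Mathlib

open Filter Asymptotics Polynomial

noncomputable section

/-- The minimal number of generators `μ(M)` of an ideal; it is the true minimum for finitely
generated ideals, hence for all ideals of a Noetherian ring. -/
def Ideal.minGenerators {R : Type*} [CommRing R] (I : Ideal R) : ℕ :=
  Submodule.spanFinrank I

/-- The `n`-th (ordinary) symbolic power
`I^(n) = ⋂_{p ∈ Min(I)} (I^n R_p ∩ R)`. -/
def Ideal.symbolicPower {R : Type*} [CommRing R] (I : Ideal R) (n : ℕ) : Ideal R :=
  ⨅ (p : PrimeSpectrum R) (_ : p.asIdeal ∈ I.minimalPrimes),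
    ((I ^ n).map (algebraMap R (Localization.AtPrime p.asIdeal))).comap
      (algebraMap R (Localization.AtPrime p.asIdeal))

theorem Ideal.mem_symbolicPower {R : Type*} [CommRing R] (I : Ideal R) (n : ℕ) (x : R) :
    x ∈ I.symbolicPower n ↔ ∀ p : PrimeSpectrum R, p.asIdeal ∈ I.minimalPrimes →
      algebraMap R (Localization.AtPrime p.asIdeal) x ∈
        (I ^ n).map (algebraMap R (Localization.AtPrime p.asIdeal)) := by
  simp [Ideal.symbolicPower, Submodule.mem_iInf, Ideal.mem_comap]

theorem Ideal.symbolicPower_zero {R : Type*} [CommRing R] (I : Ideal R) :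
    I.symbolicPower 0 = ⊤ := by
  simp [Ideal.symbolicPower, Ideal.one_eq_top, Ideal.map_top]

theorem Ideal.mul_mem_symbolicPower {R : Type*} [CommRing R] (I : Ideal R) {m n : ℕ} {x y : R}
    (hx : x ∈ I.symbolicPower m) (hy : y ∈ I.symbolicPower n) :
    x * y ∈ I.symbolicPower (m + n) := by
  rw [Ideal.mem_symbolicPower] at *
  intro p hp
  rw [map_mul, pow_add, Ideal.map_mul]
  exact Ideal.mul_mem_mul (hx p hp) (hy p hp)

/-- The symbolic Rees algebra `⊕_n I^(n) t^n`, as a subalgebra of `R[t]`. -/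
def Ideal.symbolicReesAlgebra {R : Type*} [CommRing R] (I : Ideal R) : Subalgebra R R[X] where
  carrier := {f | ∀ n, f.coeff n ∈ I.symbolicPower n}
  mul_mem' := by
    intro f g hf hg n
    rw [Polynomial.coeff_mul]
    refine Ideal.sum_mem _ fun c hc => ?_
    rw [← Finset.HasAntidiagonal.mem_antidiagonal.mp hc]
    exact I.mul_mem_symbolicPower (hf c.1) (hg c.2)
  add_mem' := by
    intro f g hf hg n
    rw [Polynomial.coeff_add]
    exact Ideal.add_mem _ (hf n) (hg n)
  algebraMap_mem' := by
    intro r n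
    rw [Polynomial.algebraMap_apply, Algebra.algebraMap_self, RingHom.id_apply,
      Polynomial.coeff_C]
    split_ifs with h
    · subst h
      rw [Ideal.symbolicPower_zero]
      trivial
    · exact Ideal.zero_mem _

/-- The set of real numbers `t ≥ 0` with `μ(𝓘_n) = O(n^(t-1))` as `n → ∞`. The restriction
`t ≥ 0` matters only when `𝓘_n` decays so fast that negative `t` occur, i.e. when `𝓘_n = 0` for
all large `n`; then every real `t` satisfies the estimate and the spread is `0` by convention. -/
def Ideal.growthExponents {R : Type*} [CommRing R] (𝓘 : ℕ → Ideal R) : Set ℝ :=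
  {t | 0 ≤ t ∧
    (fun n : ℕ => ((𝓘 n).minGenerators : ℝ)) =O[atTop] fun n : ℕ => (n : ℝ) ^ (t - 1)}

/-- The analytic spread of a system of ideals, `min {t | μ(𝓘_n) = O(n^(t-1))}`, taken as an
infimum in the extended reals (`⊤` if there is no such `t`). -/
def Ideal.analyticSpread {R : Type*} [CommRing R] (𝓘 : ℕ → Ideal R) : EReal :=
  sInf ((fun t : ℝ => (t : EReal)) '' Ideal.growthExponents 𝓘)

/-- The symbolic analytic spread of `I`. -/
def Ideal.symbolicAnalyticSpread {R : Type*} [CommRing R] (I : Ideal R) : EReal :=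
  Ideal.analyticSpread I.symbolicPower

/-- The arithmetic rank: the least `u` for which there are `g_1, …, g_u` in `R` with
`√(g_1, …, g_u) = √I`. The set of such `u` is non-empty as `R` is Noetherian. -/
def Ideal.arithmeticRank {R : Type*} [CommRing R] [IsNoetherianRing R] (I : Ideal R) : ℕ :=
  sInf {u | ∃ g : Fin u → R, (Ideal.span (Set.range g)).radical = I.radical}

/-- The depth of a local ring: the supremum of the lengths of regular sequences
in the maximal ideal. -/
def IsLocalRing.ringDepth (R : Type*) [CommRing R] [IsLocalRing R] : ℕ∞ :=
  ⨆ (rs : List R) (_ : (∀ r ∈ rs, r ∈ IsLocalRing.maximalIdeal R) ∧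
    RingTheory.Sequence.IsRegular R rs), (rs.length : ℕ∞)

/-- The Krull dimension as an extended real number (`⊥` for the zero ring), so that differences
of dimensions are taken without truncation. -/
def ringKrullDimEReal (R : Type*) [CommRing R] : EReal :=
  WithBot.recBotCoe ⊥ (fun n : ℕ∞ => ((n : ENNReal) : EReal)) (ringKrullDim R)

end

/-! Let `A` be the symbolic Rees algebra, `m` the maximal ideal of `R`, and `F = A/mA` the symbolic
fiber cone. The spread is the Krull dimension `d` of `F`, and both inequalities are read off from
this.

Upper growth bound and arithmetic rank (`exists_symbolicPower_eq_mul`): a homogeneous system of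
parameters of `F`, with all `d` members in one degree `N`, gives by Nakayama `I^(n) = (g_1, …, g_d)
I^(n-N)` for large `n`. Hence `(g)` and `I` have the same radical, and iterating gives `μ(I^(n)) =
O(n^(d-1))`.

Lower growth bound (`exists_multichoose_le_length`): a chain of `e + 1` primes over `mA` forces the
part of degree at most `n` of a quotient of `F` to have length of order at least `n^e`. This length
is at most `∑_{i ≤ n} μ(I^(i))`, so every growth exponent is at least `e`.

Bound on `d`: if `dim R/I > 0`, pick `x` in `m` outside the minimal primes of `I` and of `R`. Then
`xR ∩ I^(n) = x I^(n)`, so `F` is a quotient of the image of `A` in `(R/x)[t]`. Modulo minimal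
primes of `R/x`, such images are monomial algebras of dimension at most `dim R/x + 1`, and passing
to primes over `mA` loses one. So `d ≤ dim R/x ≤ dim R - 1`. If `dim R/I = 0`, the same argument
over `R` itself gives `d ≤ dim R`. -/

namespace Ideal

/-! ### The grading of the symbolic Rees algebra. -/

variable {R : Type*} [CommRing R] (I : Ideal R)

theorem monomial_mem_symbolicReesAlgebra {n : ℕ} {a : R} (ha : a ∈ I.symbolicPower n) :
    monomial n a ∈ I.symbolicReesAlgebra := by
  intro k
  rw [coeff_monomial]
  split_ifs with h
  · exact h ▸ ha
  · exact zero_mem _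

/-- The degree `n` part of the symbolic Rees algebra. -/
def symbolicReesPiece (n : ℕ) : Submodule R I.symbolicReesAlgebra where
  carrier := {f | ∀ k, k ≠ n → (f : R[X]).coeff k = 0}
  add_mem' hf hg k hk := by simp [hf k hk, hg k hk]
  zero_mem' k _ := by simp
  smul_mem' r f hf k hk := by simp [hf k hk]

/-- The monomial `a t^n` as an element of the symbolic Rees algebra. -/
noncomputable def symbolicReesMonomial (n : ℕ) :
    I.symbolicPower n →ₗ[R] I.symbolicReesAlgebra where
  toFun a := ⟨monomial n (a : R), I.monomial_mem_symbolicReesAlgebra a.2⟩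
  map_add' a b := by ext1; simp
  map_smul' r a := by ext1; simp [smul_monomial]

@[simp]
theorem coe_symbolicReesMonomial (n : ℕ) (a : I.symbolicPower n) :
    (I.symbolicReesMonomial n a : R[X]) = monomial n (a : R) := rfl

theorem symbolicReesMonomial_mem (n : ℕ) (a : I.symbolicPower n) :
    I.symbolicReesMonomial n a ∈ I.symbolicReesPiece n := by
  intro k hk
  simp [coeff_monomial, hk.symm]

theorem eq_symbolicReesMonomial {n : ℕ} {f : I.symbolicReesAlgebra}
    (hf : f ∈ I.symbolicReesPiece n) :
    f = I.symbolicReesMonomial n ⟨(f : R[X]).coeff n, f.2 n⟩ := by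
  ext k
  rw [coe_symbolicReesMonomial, coeff_monomial]
  split_ifs with h
  · rw [h]
  · exact hf k (Ne.symm h)

theorem symbolicReesPiece_eq_range (n : ℕ) :
    I.symbolicReesPiece n = LinearMap.range (I.symbolicReesMonomial n) := by
  ext f
  constructor
  · intro hf
    exact ⟨_, (I.eq_symbolicReesMonomial hf).symm⟩
  · rintro ⟨a, rfl⟩
    exact I.symbolicReesMonomial_mem n a

/-- The degree `n` component of an element of the symbolic Rees algebra. -/
noncomputable def symbolicReesComponent (n : ℕ) :
    I.symbolicReesAlgebra →ₗ[R] I.symbolicReesPiece n where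
  toFun f := ⟨I.symbolicReesMonomial n ⟨(f : R[X]).coeff n, f.2 n⟩,
    I.symbolicReesMonomial_mem n _⟩
  map_add' f g := by ext1; ext1; simp
  map_smul' r f := by ext1; ext1; simp [smul_monomial]

theorem coe_symbolicReesComponent (n : ℕ) (f : I.symbolicReesAlgebra) :
    ((I.symbolicReesComponent n f : I.symbolicReesAlgebra) : R[X]) =
      monomial n ((f : R[X]).coeff n) := rfl

theorem symbolicReesComponent_of_mem {n : ℕ} (f : I.symbolicReesPiece n) :
    I.symbolicReesComponent n f = f := by
  ext1
  exact (I.eq_symbolicReesMonomial f.2).symm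

theorem symbolicReesComponent_of_ne {n k : ℕ} (h : n ≠ k) (f : I.symbolicReesPiece k) :
    I.symbolicReesComponent n f = 0 := by
  ext1; ext1
  simp [coe_symbolicReesComponent, f.2 n h]

noncomputable instance : GradedAlgebra I.symbolicReesPiece where
  one_mem := by
    intro k hk
    simp [coeff_one, hk]
  mul_mem := by
    intro i j f g hf hg
    rw [I.eq_symbolicReesMonomial hf, I.eq_symbolicReesMonomial hg]
    intro k hk
    simp [monomial_mul_monomial, coeff_monomial, hk.symm]
  decompose' f := DFinsupp.mk (f : R[X]).support fun i => I.symbolicReesComponent i f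
  left_inv f := by
    ext1
    have h : (DirectSum.coeAddMonoidHom I.symbolicReesPiece)
        (DFinsupp.mk (f : R[X]).support fun i => I.symbolicReesComponent i f) =
        ∑ i ∈ (f : R[X]).support, (I.symbolicReesComponent i f : I.symbolicReesAlgebra) := by
      have h2 : (DFinsupp.mk (f : R[X]).support (fun i => I.symbolicReesComponent i f) :
          DirectSum ℕ fun i => I.symbolicReesPiece i) =
          ∑ i ∈ (f : R[X]).support, DirectSum.of (fun i => I.symbolicReesPiece i) i
            (I.symbolicReesComponent i f) := by
        refine DFinsupp.ext fun k => ?_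
        rw [DFinsupp.finsetSum_apply]
        simp only [DFinsupp.mk_apply]
        split_ifs with h
        · rw [Finset.sum_eq_single k]
          · exact (DirectSum.of_eq_same (β := fun i => I.symbolicReesPiece i) _ _).symm
          · intro b _ hb
            exact DirectSum.of_eq_of_ne (β := fun i => I.symbolicReesPiece i) _ _ _ hb.symm
          · exact fun h' => absurd h h'
        · symm
          refine Finset.sum_eq_zero fun b hb => ?_
          exact DirectSum.of_eq_of_ne (β := fun i => I.symbolicReesPiece i) _ _ _ (fun e => h (e ▸ hb))
      rw [h2, map_sum]
      simp
    rw [h]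
    simp only [AddSubmonoidClass.coe_finsetSum, coe_symbolicReesComponent]
    exact (as_sum_support (f : R[X])).symm
  right_inv x := by
    refine DFinsupp.ext fun k => ?_
    have h : ∀ f : I.symbolicReesAlgebra,
        (DFinsupp.mk (f : R[X]).support (fun i => I.symbolicReesComponent i f) :
          DirectSum ℕ fun i => I.symbolicReesPiece i) k = I.symbolicReesComponent k f := by
      intro f
      rw [DFinsupp.mk_apply]
      split_ifs with h
      · rfl
      · ext1; ext1
        simp [coe_symbolicReesComponent, notMem_support_iff.mp h]
    rw [h]
    induction x using DirectSum.induction_on with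
    | zero => simp
    | of i x =>
      rw [DirectSum.coeAddMonoidHom_of]
      by_cases hik : k = i
      · subst hik
        rw [symbolicReesComponent_of_mem]
        exact (DirectSum.of_eq_same (β := fun i => I.symbolicReesPiece i) k x).symm
      · rw [symbolicReesComponent_of_ne _ hik]
        exact (DirectSum.of_eq_of_ne (β := fun i => I.symbolicReesPiece i) _ _ _ hik).symm
    | add x y hx hy => rw [map_add, map_add, hx, hy]; rfl

theorem decompose_symbolicReesPiece (f : I.symbolicReesAlgebra) (n : ℕ) :
    DirectSum.decompose I.symbolicReesPiece f n = I.symbolicReesComponent n f := by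
  change (DFinsupp.mk (f : R[X]).support (fun i => I.symbolicReesComponent i f) :
    DirectSum ℕ fun i => I.symbolicReesPiece i) n = _
  rw [DFinsupp.mk_apply]
  split_ifs with h
  · rfl
  · ext1; ext1
    simp [coe_symbolicReesComponent, notMem_support_iff.mp h]

end Ideal

/-! ### Generators of Noetherian graded algebras. -/

section Graded

variable {R A : Type*} [CommRing R] [CommRing A] [Algebra R A] (𝒜 : ℕ → Submodule R A)
  [GradedAlgebra 𝒜]

/-- Take degree `n` components in any expression of `a`. As `n - d x` truncates, generators of
degree above `n` must get coefficient zero explicitly. -/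
theorem GradedAlgebra.exists_eq_sum_of_mem_span {s : Finset A} {d : A → ℕ}
    (hd : ∀ x ∈ s, x ∈ 𝒜 (d x)) {n : ℕ} {a : A} (ha : a ∈ 𝒜 n)
    (has : a ∈ Ideal.span (s : Set A)) :
    ∃ c : A → A, (∀ x ∈ s, c x ∈ 𝒜 (n - d x) ∧ (n < d x → c x = 0)) ∧
      a = ∑ x ∈ s, c x * x := by
  classical
  obtain ⟨f, -, hf⟩ := Submodule.mem_span_finset.mp has
  refine ⟨fun x => if d x ≤ n then DirectSum.decompose 𝒜 (f x) (n - d x) else 0, ?_, ?_⟩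
  · intro x hx
    constructor
    · dsimp only
      split_ifs
      · exact SetLike.coe_mem _
      · exact zero_mem _
    · intro h
      simp [not_le.mpr h]
  · have h := congrArg (fun y => (DirectSum.decompose 𝒜 y n : A)) hf
    simp only [DirectSum.decompose_of_mem_same 𝒜 ha] at h
    rw [← h, DirectSum.decompose_sum, DFinsupp.finsetSum_apply, AddSubmonoidClass.coe_finsetSum]
    refine Finset.sum_congr rfl fun x hx => ?_
    rw [smul_eq_mul, DirectSum.coe_decompose_mul_of_right_mem 𝒜 n (hd x hx)]
    dsimp only
    by_cases h : d x ≤ n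
    · rw [if_pos h, if_pos h]
    · rw [if_neg h, if_neg h, zero_mul]

theorem GradedAlgebra.exists_finset_span_eq_irrelevant [IsNoetherianRing A] :
    ∃ (s : Finset A) (d : A → ℕ), (∀ x ∈ s, 0 < d x ∧ x ∈ 𝒜 (d x)) ∧
      Ideal.span (s : Set A) = (HomogeneousIdeal.irrelevant 𝒜).toIdeal := by
  have h := HomogeneousIdeal.irrelevant_eq_span 𝒜
  have hfg : (Ideal.span (⋃ i > 0, (𝒜 i : Set A))).FG := IsNoetherian.noetherian _
  obtain ⟨s, hs, hs'⟩ := (Submodule.fg_span_iff_fg_span_finset_subset _).mp hfg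
  have : ∀ x : A, ∃ i, x ∈ s → 0 < i ∧ x ∈ 𝒜 i := by
    intro x
    by_cases hx : x ∈ s
    · have := hs hx
      simp only [Set.mem_iUnion] at this
      obtain ⟨i, hi, hx⟩ := this
      exact ⟨i, fun _ => ⟨hi, hx⟩⟩
    · exact ⟨0, fun h => absurd h hx⟩
  choose d hd using this
  exact ⟨s, d, hd, by rw [h]; exact hs'.symm⟩

theorem GradedAlgebra.exists_le_irrelevant_pow [IsNoetherianRing A] (N : ℕ) :
    ∃ n₀, ∀ n ≥ n₀, ∀ a ∈ 𝒜 n, a ∈ (HomogeneousIdeal.irrelevant 𝒜).toIdeal ^ N := by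
  obtain ⟨s, d, hd, hs⟩ := exists_finset_span_eq_irrelevant 𝒜
  induction N with
  | zero => exact ⟨0, by simp⟩
  | succ N ih =>
    obtain ⟨n₀, h₀⟩ := ih
    -- Removing a generator costs at most `s.sup d`, leaving degree at least `n₀`; the `+ 1` puts
    -- `a` in the irrelevant ideal.
    refine ⟨n₀ + s.sup d + 1, fun n hn a ha => ?_⟩
    have : a ∈ Ideal.span (s : Set A) := by
      rw [hs]
      exact HomogeneousIdeal.mem_irrelevant_of_mem 𝒜 (by omega : 0 < n) ha
    obtain ⟨c, hc, rfl⟩ := exists_eq_sum_of_mem_span 𝒜 (fun x hx => (hd x hx).2) ha this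
    refine Ideal.sum_mem _ fun x hx => ?_
    rw [pow_succ]
    refine Ideal.mul_mem_mul (h₀ _ ?_ _ (hc x hx).1) ?_
    · have := Finset.le_sup (f := d) hx
      omega
    · rw [← hs]
      exact Ideal.subset_span hx

/-- Ideal generators of the irrelevant ideal are algebra generators, by induction on degree: the
coefficients have smaller degree. -/
theorem GradedAlgebra.exists_finset_adjoin_eq_top [IsNoetherianRing A]
    (h0 : ∀ a ∈ 𝒜 0, a ∈ (⊥ : Subalgebra R A)) :
    ∃ (s : Finset A) (d : A → ℕ), (∀ x ∈ s, 0 < d x ∧ x ∈ 𝒜 (d x)) ∧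
      Algebra.adjoin R (s : Set A) = ⊤ := by
  obtain ⟨s, d, hd, hs⟩ := exists_finset_span_eq_irrelevant 𝒜
  refine ⟨s, d, hd, ?_⟩
  have key : ∀ n, ∀ a ∈ 𝒜 n, a ∈ Algebra.adjoin R (s : Set A) := by
    intro n
    induction n using Nat.strong_induction_on with
    | _ n ih =>
      intro a ha
      rcases Nat.eq_zero_or_pos n with rfl | hn
      · exact (bot_le : (⊥ : Subalgebra R A) ≤ _) (h0 a ha)
      have : a ∈ Ideal.span (s : Set A) := by
        rw [hs]
        exact HomogeneousIdeal.mem_irrelevant_of_mem 𝒜 hn ha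
      obtain ⟨c, hc, rfl⟩ := exists_eq_sum_of_mem_span 𝒜 (fun x hx => (hd x hx).2) ha this
      refine sum_mem fun x hx => mul_mem (ih _ ?_ _ (hc x hx).1) (Algebra.subset_adjoin hx)
      have := (hd x hx).1
      omega
  classical
  rw [eq_top_iff]
  intro a _
  rw [← DirectSum.sum_support_decompose 𝒜 a]
  exact sum_mem fun i _ => key i _ (SetLike.coe_mem _)

end Graded

/-! ### Dimension drop in quotients. -/

section Dimension

variable {A : Type*} [CommRing A]

/-- If every prime over `J` strictly contains a prime over `K`, then the dimension drops. -/
theorem ringKrullDim_quotient_succ_le_of_forall_exists_lt {K J : Ideal A} (hKJ : K ≤ J)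
    (h : ∀ P : Ideal A, P.IsPrime → J ≤ P → ∃ Q : Ideal A, Q.IsPrime ∧ K ≤ Q ∧ Q < P) :
    ringKrullDim (A ⧸ J) + 1 ≤ ringKrullDim (A ⧸ K) := by
  rw [ringKrullDim_quotient, ringKrullDim_quotient]
  rcases isEmpty_or_nonempty (PrimeSpectrum.zeroLocus (J : Set A)) with he | hne
  · rw [Order.krullDim_eq_bot]
    simp
  rw [Order.krullDim_eq_iSup_length (α := PrimeSpectrum.zeroLocus (J : Set A))]
  have hs : ∀ p : LTSeries (PrimeSpectrum.zeroLocus (J : Set A)),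
      ((p.length + 1 : ℕ) : WithBot ℕ∞) ≤
        Order.krullDim (PrimeSpectrum.zeroLocus (K : Set A)) := by
    intro p
    obtain ⟨Q, hQ, hKQ, hlt⟩ := h p.head.1.asIdeal p.head.1.2 p.head.2
    have hsub : PrimeSpectrum.zeroLocus (J : Set A) ⊆ PrimeSpectrum.zeroLocus (K : Set A) :=
      PrimeSpectrum.zeroLocus_anti_mono hKJ
    let q : LTSeries (PrimeSpectrum.zeroLocus (K : Set A)) :=
      p.map (Set.inclusion hsub) (fun a b hab => hab)
    have hq : (⟨⟨Q, hQ⟩, hKQ⟩ : PrimeSpectrum.zeroLocus (K : Set A)) < q.head := hlt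
    have hlen : (q.cons _ hq).length = p.length + 1 := RelSeries.cons_length ..
    rw [← hlen]
    exact Order.LTSeries.length_le_krullDim _
  have : ((⨆ p : LTSeries (PrimeSpectrum.zeroLocus (J : Set A)), (p.length : ℕ∞)) + 1 : ℕ∞) =
      ⨆ p : LTSeries (PrimeSpectrum.zeroLocus (J : Set A)), ((p.length : ℕ∞) + 1) :=
    ENat.iSup_add ..
  rw [← WithBot.coe_one, ← WithBot.coe_add, this]
  obtain ⟨p0⟩ : Nonempty (LTSeries (PrimeSpectrum.zeroLocus (J : Set A))) := inferInstance
  have h0 := hs p0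
  generalize Order.krullDim (PrimeSpectrum.zeroLocus (K : Set A)) = D at hs h0
  induction D with
  | bot => simp at h0
  | coe D =>
    rw [WithBot.coe_le_coe]
    refine iSup_le fun p => ?_
    have := hs p
    exact WithBot.coe_le_coe.mp (by simpa using this)

theorem ringKrullDim_quotient_sup_span_succ_le {K : Ideal A} {g : A}
    (hg : ∀ P ∈ K.minimalPrimes, g ∉ P) :
    ringKrullDim (A ⧸ (K ⊔ Ideal.span {g})) + 1 ≤ ringKrullDim (A ⧸ K) := by
  refine ringKrullDim_quotient_succ_le_of_forall_exists_lt le_sup_left fun P hP hle => ?_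
  obtain ⟨Q, hQ, hQP⟩ := Ideal.exists_minimalPrimes_le (le_sup_left.trans hle)
  refine ⟨Q, hQ.1.1, hQ.1.2, lt_of_le_of_ne hQP ?_⟩
  rintro rfl
  exact hg Q hQ (hle (Ideal.mem_sup_right (Ideal.mem_span_singleton_self g)))

end Dimension

/-! ### Homogeneous prime avoidance and systems of parameters. -/

section Graded

variable {R A : Type*} [CommRing R] [CommRing A] [Algebra R A] (𝒜 : ℕ → Submodule R A)
  [GradedAlgebra 𝒜]

/-- The homogeneous core of `P` is a prime still containing `K`, so minimality forces it to be `P`.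
-/
theorem Ideal.IsHomogeneous.of_mem_minimalPrimes {K P : Ideal A} (hK : K.IsHomogeneous 𝒜)
    (hP : P ∈ K.minimalPrimes) : P.IsHomogeneous 𝒜 := by
  have hle : (P.homogeneousCore 𝒜).toIdeal ≤ P := Ideal.toIdeal_homogeneousCore_le 𝒜 P
  have hprime : (P.homogeneousCore 𝒜).toIdeal.IsPrime := hP.1.1.homogeneousCore
  have hKle : K ≤ (P.homogeneousCore 𝒜).toIdeal :=
    hK.toIdeal_homogeneousCore_eq_self.symm.trans_le (Ideal.homogeneousCore_mono _ hP.1.2)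
  have : (P.homogeneousCore 𝒜).toIdeal = P := le_antisymm hle (hP.2 ⟨hprime, hKle⟩ hle)
  rw [← this]
  exact HomogeneousIdeal.isHomogeneous _

theorem Ideal.IsHomogeneous.exists_homogeneous_notMem {P Q : Ideal A} (hP : P.IsHomogeneous 𝒜)
    (h : ¬ P ≤ Q) : ∃ n, ∃ f ∈ 𝒜 n, f ∈ P ∧ f ∉ Q := by
  classical
  by_contra! hcon
  refine h fun x hx => ?_
  rw [← DirectSum.sum_support_decompose 𝒜 x]
  exact Ideal.sum_mem _ fun i _ => hcon i _ (SetLike.coe_mem _) (hP i hx)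

theorem GradedAlgebra.exists_homogeneous_notMem_of_not_irrelevant_le {Q : Ideal A}
    (h : ¬ (HomogeneousIdeal.irrelevant 𝒜).toIdeal ≤ Q) : ∃ n > 0, ∃ f ∈ 𝒜 n, f ∉ Q := by
  by_contra! hcon
  refine h ?_
  rw [HomogeneousIdeal.irrelevant_eq_span, Ideal.span_le]
  intro x hx
  simp only [Set.mem_iUnion] at hx
  obtain ⟨i, hi, hx⟩ := hx
  exact hcon i hi x hx

/-- Homogeneous prime avoidance for pairwise incomparable relevant primes. -/
theorem GradedAlgebra.exists_homogeneous_forall_notMem (T : Finset (Ideal A))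
    (hprime : ∀ P ∈ T, P.IsPrime) (hhom : ∀ P ∈ T, P.IsHomogeneous 𝒜)
    (hirr : ∀ P ∈ T, ¬ (HomogeneousIdeal.irrelevant 𝒜).toIdeal ≤ P)
    (hanti : ∀ P ∈ T, ∀ Q ∈ T, P ≤ Q → P = Q) :
    ∃ n > 0, ∃ g ∈ 𝒜 n, ∀ P ∈ T, g ∉ P := by
  classical
  induction T using Finset.induction_on with
  | empty => exact ⟨1, one_pos, 0, zero_mem _, by simp⟩
  | insert Q T hQT ih =>
    simp only [Finset.mem_insert, forall_eq_or_imp] at hprime hhom hirr hanti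
    obtain ⟨n, hn, g, hg, hgT⟩ := ih hprime.2 hhom.2 hirr.2
      (fun P hP P' hP' => (hanti.2 P hP).2 P' hP')
    by_cases hgQ : g ∈ Q
    swap
    · exact ⟨n, hn, g, hg, by simpa using ⟨hgQ, hgT⟩⟩
    have hQ := hprime.1
    have hex : ∀ P : Ideal A, ∃ k f, P ∈ T → f ∈ 𝒜 k ∧ f ∈ P ∧ f ∉ Q := by
      intro P
      by_cases hP : P ∈ T
      · obtain ⟨k, f, h⟩ := (hhom.2 P hP).exists_homogeneous_notMem 𝒜 (Q := Q)
          (fun hle => hQT ((hanti.2 P hP).1 hle ▸ hP))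
        exact ⟨k, f, fun _ => h⟩
      · exact ⟨0, 0, fun h => absurd h hP⟩
    choose k f hf using hex
    obtain ⟨m, hm, h, hh, hhQ⟩ := exists_homogeneous_notMem_of_not_irrelevant_le 𝒜 hirr.1
    have hF : h * ∏ P ∈ T, f P ∈ 𝒜 (m + ∑ P ∈ T, k P) :=
      SetLike.mul_mem_graded hh (SetLike.prod_mem_graded 𝒜 k f fun P hP => (hf P hP).1)
    have hFQ : h * ∏ P ∈ T, f P ∉ Q := by
      intro hmem
      rcases hQ.mem_or_mem hmem with h1 | h1
      · exact hhQ h1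
      · obtain ⟨P, hP, h2⟩ := (hQ.prod_mem_iff).mp h1
        exact (hf P hP).2.2 h2
    have hFT : ∀ P ∈ T, h * ∏ P ∈ T, f P ∈ P := fun P hP =>
      Ideal.mul_mem_left _ _ (Ideal.mem_of_dvd _ (Finset.dvd_prod_of_mem f hP) (hf P hP).2.1)
    set F := h * ∏ P ∈ T, f P
    set l := m + ∑ P ∈ T, k P
    have hl : 0 < l := by omega
    -- The powers equalize degrees. Each prime contains exactly one summand: `Q` contains `g` but
    -- not `F`, and members of `T` contain `F` but not `g`.
    refine ⟨l * n, Nat.mul_pos hl hn, g ^ l + F ^ n, ?_, ?_⟩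
    · refine add_mem ?_ ?_
      · simpa using SetLike.pow_mem_graded l hg
      · simpa [mul_comm] using SetLike.pow_mem_graded n hF
    · simp only [Finset.mem_insert, forall_eq_or_imp]
      refine ⟨fun hmem => hFQ ?_, fun P hP hmem => hgT P hP ?_⟩
      · exact hQ.mem_of_pow_mem n
          ((Ideal.add_mem_iff_right _ (Ideal.pow_mem_of_mem _ hgQ _ hl)).mp hmem)
      · exact (hprime.2 P hP).mem_of_pow_mem l
          ((Ideal.add_mem_iff_left _ (Ideal.pow_mem_of_mem _ (hFT P hP) _ hn)).mp hmem)

/-- Existence of homogeneous systems of parameters. -/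
theorem GradedAlgebra.exists_irrelevant_le_radical [IsNoetherianRing A] (M : Ideal A)
    [M.IsMaximal] (hM : (HomogeneousIdeal.irrelevant 𝒜).toIdeal ≤ M) (d : ℕ) (K : Ideal A)
    (hK : K.IsHomogeneous 𝒜)
    (hKM : ∀ P : Ideal A, P.IsPrime → P.IsHomogeneous 𝒜 → K ≤ P → P ≤ M)
    (hirr : ∀ P : Ideal A, K ≤ P → (HomogeneousIdeal.irrelevant 𝒜).toIdeal ≤ P → M ≤ P)
    (hd : ringKrullDim (A ⧸ K) ≤ d) :
    ∃ g : Fin d → A, (∀ i, ∃ n > 0, g i ∈ 𝒜 n) ∧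
      (HomogeneousIdeal.irrelevant 𝒜).toIdeal ≤ (K ⊔ Ideal.span (Set.range g)).radical := by
  induction d generalizing K with
  | zero =>
    refine ⟨Fin.elim0, fun i => i.elim0, ?_⟩
    have : K.radical ≤ (K ⊔ Ideal.span (Set.range (Fin.elim0 : Fin 0 → A))).radical :=
      Ideal.radical_mono le_sup_left
    refine le_trans ?_ this
    rw [hK.radical_eq]
    refine le_sInf fun P ⟨hPh, hKP, hP⟩ => ?_
    have hPM := hKM P hP hPh hKP
    suffices P = M by rw [this]; exact hM
    -- A homogeneous prime over `K` other than `M` would lie strictly below `M`, giving dimension at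
    -- least one.
    by_contra hne
    have h1 : ringKrullDim (A ⧸ M) + 1 ≤ ringKrullDim (A ⧸ K) := by
      refine ringKrullDim_quotient_succ_le_of_forall_exists_lt (hKP.trans hPM)
        fun Q hQ hMQ => ⟨P, hP, hKP, lt_of_lt_of_le (lt_of_le_of_ne hPM hne) hMQ⟩
    have h2 : (0 : WithBot ℕ∞) ≤ ringKrullDim (A ⧸ M) := ringKrullDim_nonneg_of_nontrivial
    have h3 := (add_le_add_left h2 1).trans (h1.trans hd)
    norm_num at h3
  | succ d ih =>
    -- Here avoidance is impossible, since `M` contains the irrelevant ideal. But then `M` is the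
    -- only homogeneous prime over `K`, and zero parameters suffice.
    by_cases hmin : M ∈ K.minimalPrimes
    · refine ⟨0, fun i => ⟨1, one_pos, zero_mem _⟩, ?_⟩
      refine le_trans ?_ (Ideal.radical_mono le_sup_left)
      rw [hK.radical_eq]
      refine le_sInf fun P ⟨hPh, hKP, hP⟩ => ?_
      exact hM.trans (hmin.2 ⟨hP, hKP⟩ (hKM P hP hPh hKP))
    have hfin : K.minimalPrimes.Finite := Ideal.finite_minimalPrimes_of_isNoetherianRing A K
    obtain ⟨n, hn, g, hg, hgP⟩ := exists_homogeneous_forall_notMem 𝒜 hfin.toFinset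
      (fun P hP => ((hfin.mem_toFinset).mp hP).1.1)
      (fun P hP => hK.of_mem_minimalPrimes 𝒜 ((hfin.mem_toFinset).mp hP))
      (fun P hP hle => by
        have hP := (hfin.mem_toFinset).mp hP
        have h1 := hirr P hP.1.2 hle
        have h2 := hKM P hP.1.1 (hK.of_mem_minimalPrimes 𝒜 hP) hP.1.2
        exact hmin (le_antisymm h2 h1 ▸ hP))
      (fun P hP Q hQ hle => le_antisymm hle
        (((hfin.mem_toFinset).mp hQ).2 ((hfin.mem_toFinset).mp hP).1 hle))
    have hdim := ringKrullDim_quotient_sup_span_succ_le (K := K) (g := g)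
      (fun P hP => hgP P ((hfin.mem_toFinset).mpr hP))
    have hdim' : ringKrullDim (A ⧸ (K ⊔ Ideal.span {g})) ≤ d := by
      have h := hdim.trans hd
      push_cast at h
      exact ENat.WithBot.add_le_add_one_right_iff.mp h
    obtain ⟨g', hg', hle⟩ := ih (K ⊔ Ideal.span {g})
      (hK.sup (Ideal.homogeneous_span 𝒜 _ (by rintro x rfl; exact ⟨n, hg⟩)))
      (fun P hP hPh hKP => hKM P hP hPh (le_sup_left.trans hKP))
      (fun P hKP => hirr P (le_sup_left.trans hKP)) hdim'
    refine ⟨Fin.cons g g', ?_, ?_⟩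
    · intro i
      refine Fin.cases ⟨n, hn, ?_⟩ (fun i => ?_) i
      · simpa using hg
      · simpa using hg' i
    · rw [Fin.range_cons, Set.insert_eq, Ideal.span_union, ← sup_assoc]
      exact hle

/-- Homogeneous systems of parameters whose members all have the same degree. -/
theorem GradedAlgebra.exists_irrelevant_le_radical_of_same_degree [IsNoetherianRing A]
    (M : Ideal A) [M.IsMaximal] (hM : (HomogeneousIdeal.irrelevant 𝒜).toIdeal ≤ M) (d : ℕ)
    (K : Ideal A) (hK : K.IsHomogeneous 𝒜)
    (hKM : ∀ P : Ideal A, P.IsPrime → P.IsHomogeneous 𝒜 → K ≤ P → P ≤ M)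
    (hirr : ∀ P : Ideal A, K ≤ P → (HomogeneousIdeal.irrelevant 𝒜).toIdeal ≤ P → M ≤ P)
    (hd : ringKrullDim (A ⧸ K) ≤ d) :
    ∃ N > 0, ∃ g : Fin d → A, (∀ i, g i ∈ 𝒜 N) ∧
      (HomogeneousIdeal.irrelevant 𝒜).toIdeal ≤ (K ⊔ Ideal.span (Set.range g)).radical := by
  obtain ⟨g, hg, hle⟩ := exists_irrelevant_le_radical 𝒜 M hM d K hK hKM hirr hd
  choose n hn hgn using hg
  refine ⟨∏ i, n i, Finset.prod_pos fun i _ => hn i,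
    fun i => g i ^ (∏ j ∈ Finset.univ.erase i, n j), fun i => ?_, hle.trans ?_⟩
  · have := SetLike.pow_mem_graded (∏ j ∈ Finset.univ.erase i, n j) (hgn i)
    rwa [smul_eq_mul, mul_comm, Finset.mul_prod_erase _ _ (Finset.mem_univ i)] at this
  · rw [Ideal.radical_le_radical_iff, sup_le_iff, Ideal.span_le]
    refine ⟨le_sup_left.trans Ideal.le_radical, ?_⟩
    rintro _ ⟨i, rfl⟩
    exact ⟨_, Ideal.mem_sup_right (Ideal.subset_span ⟨i, rfl⟩)⟩

/-- A homogeneous ideal whose radical contains the irrelevant ideal contains all pieces of large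
degree. -/
theorem GradedAlgebra.exists_forall_mem_of_irrelevant_le_radical [IsNoetherianRing A]
    {J : Ideal A} (hJ : (HomogeneousIdeal.irrelevant 𝒜).toIdeal ≤ J.radical) :
    ∃ n₀, ∀ n ≥ n₀, ∀ a ∈ 𝒜 n, a ∈ J := by
  obtain ⟨N, hN⟩ := Ideal.exists_pow_le_of_le_radical_of_fg hJ (IsNoetherian.noetherian _)
  obtain ⟨n₀, h⟩ := exists_le_irrelevant_pow 𝒜 N
  exact ⟨n₀, fun n hn a ha => hN (h n hn a ha)⟩

end Graded

/-! ### Ideals of the symbolic Rees algebra in terms of coefficients; its homogeneous maximal ideal.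
-/

namespace Ideal

variable {R : Type*} [CommRing R] (I : Ideal R)

theorem pow_le_symbolicPower (n : ℕ) : I ^ n ≤ I.symbolicPower n := by
  intro x hx
  rw [mem_symbolicPower]
  exact fun p _ => mem_map_of_mem _ hx

theorem symbolicPower_le_radical {n : ℕ} (hn : 0 < n) : I.symbolicPower n ≤ I.radical := by
  intro x hx
  rw [mem_symbolicPower] at hx
  rw [← sInf_minimalPrimes]
  refine Submodule.mem_sInf.mpr fun (p : Ideal R) hp => ?_
  have hp' : p.IsPrime := hp.1.1
  have h1 := hx ⟨p, hp'⟩ hp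
  have h2 : (I ^ n).map (algebraMap R (Localization.AtPrime p)) ≤
      IsLocalRing.maximalIdeal (Localization.AtPrime p) := by
    rw [← Localization.AtPrime.map_eq_maximalIdeal]
    exact map_mono ((pow_le_self hn.ne').trans hp.1.2)
  exact (IsLocalization.AtPrime.to_map_mem_maximal_iff _ p x).mp (h2 h1)

theorem symbolicPower_mul_le (m n : ℕ) :
    I.symbolicPower m * I.symbolicPower n ≤ I.symbolicPower (m + n) :=
  mul_le.mpr fun _ hx _ hy => I.mul_mem_symbolicPower hx hy

/-- With `coeff_mem_of_mem_span`, this turns ideal membership in the Rees algebra into products of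
ideals of `R`, where Nakayama applies. -/
theorem coeff_mem_of_mem_map {J : Ideal R} {f : I.symbolicReesAlgebra}
    (hf : f ∈ J.map (algebraMap R I.symbolicReesAlgebra)) (n : ℕ) :
    (f : R[X]).coeff n ∈ J * I.symbolicPower n := by
  have hf' : f ∈ (J • (⊤ : Submodule R I.symbolicReesAlgebra)) := by
    rw [Ideal.smul_top_eq_map]
    exact hf
  induction hf' using Submodule.smul_induction_on' with
  | smul r hr g hg =>
    have : ((r • g : I.symbolicReesAlgebra) : R[X]).coeff n = r * (g : R[X]).coeff n := by simp
    rw [this]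
    exact mul_mem_mul hr (g.2 n)
  | add x hx y hy h1 h2 =>
    have : ∀ z ∈ (J • (⊤ : Submodule R I.symbolicReesAlgebra)),
        z ∈ J.map (algebraMap R I.symbolicReesAlgebra) := by
      intro z hz
      rw [Ideal.smul_top_eq_map] at hz
      exact hz
    simpa using add_mem (h1 (this x hx)) (h2 (this y hy))

theorem coeff_mul_of_mem_symbolicReesPiece {N n : ℕ} (hn : N ≤ n) (a : I.symbolicReesAlgebra)
    {g : I.symbolicReesAlgebra} (hg : g ∈ I.symbolicReesPiece N) :
    ((a * g : I.symbolicReesAlgebra) : R[X]).coeff n =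
      (g : R[X]).coeff N * (a : R[X]).coeff (n - N) := by
  have h1 : (g : R[X]) = monomial N ((g : R[X]).coeff N) :=
    congrArg Subtype.val (I.eq_symbolicReesMonomial hg)
  have h2 : ((a * g : I.symbolicReesAlgebra) : R[X]) = (a : R[X]) * (g : R[X]) := rfl
  obtain ⟨k, rfl⟩ := Nat.exists_eq_add_of_le' hn
  rw [h2, Nat.add_sub_cancel, h1, coeff_mul_monomial, coeff_monomial, if_pos rfl, mul_comm]

theorem coeff_mem_of_mem_span {ι : Type*} [Fintype ι] {N : ℕ} {g : ι → I.symbolicReesAlgebra}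
    (hg : ∀ i, g i ∈ I.symbolicReesPiece N) {f : I.symbolicReesAlgebra}
    (hf : f ∈ span (Set.range g)) {n : ℕ} (hn : N ≤ n) :
    (f : R[X]).coeff n ∈
      span (Set.range fun i => (g i : R[X]).coeff N) * I.symbolicPower (n - N) := by
  obtain ⟨c, rfl⟩ := mem_span_range_iff_exists_fun.mp hf
  rw [AddSubmonoidClass.coe_finsetSum, finsetSum_coeff]
  refine Ideal.sum_mem _ fun i _ => ?_
  rw [I.coeff_mul_of_mem_symbolicReesPiece hn _ (hg i)]
  exact mul_mem_mul (subset_span ⟨i, rfl⟩) ((c i).2 _)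

/-- The constant coefficient on the symbolic Rees algebra. -/
noncomputable def symbolicReesConstantCoeff : I.symbolicReesAlgebra →+* R :=
  (constantCoeff : R[X] →+* R).comp I.symbolicReesAlgebra.val.toRingHom

theorem symbolicReesConstantCoeff_apply (f : I.symbolicReesAlgebra) :
    I.symbolicReesConstantCoeff f = (f : R[X]).coeff 0 := rfl

theorem symbolicReesConstantCoeff_surjective :
    Function.Surjective I.symbolicReesConstantCoeff := fun r =>
  ⟨algebraMap R _ r, by simp [symbolicReesConstantCoeff_apply]⟩

theorem eq_algebraMap_of_mem_symbolicReesPiece_zero {f : I.symbolicReesAlgebra}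
    (hf : f ∈ I.symbolicReesPiece 0) :
    f = algebraMap R I.symbolicReesAlgebra ((f : R[X]).coeff 0) := by
  ext k
  have : ((algebraMap R I.symbolicReesAlgebra ((f : R[X]).coeff 0) : I.symbolicReesAlgebra) : R[X])
    = C ((f : R[X]).coeff 0) := rfl
  rw [this, coeff_C]
  split_ifs with h
  · rw [h]
  · exact hf k h

section Local

variable [IsLocalRing R]

/-- The extension of the maximal ideal of `R` to the symbolic Rees algebra; the quotient by it is
the symbolic fiber cone. -/
noncomputable abbrev symbolicFiberIdeal : Ideal I.symbolicReesAlgebra :=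
  (IsLocalRing.maximalIdeal R).map (algebraMap R I.symbolicReesAlgebra)

/-- The homogeneous maximal ideal of the symbolic Rees algebra of an ideal in a local ring. -/
noncomputable def symbolicReesMaximalIdeal : Ideal I.symbolicReesAlgebra :=
  (IsLocalRing.maximalIdeal R).comap I.symbolicReesConstantCoeff

instance : I.symbolicReesMaximalIdeal.IsMaximal :=
  comap_isMaximal_of_surjective _ I.symbolicReesConstantCoeff_surjective

theorem irrelevant_le_symbolicReesMaximalIdeal :
    (HomogeneousIdeal.irrelevant I.symbolicReesPiece).toIdeal ≤ I.symbolicReesMaximalIdeal := by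
  rw [HomogeneousIdeal.irrelevant_eq_span, span_le]
  intro x hx
  simp only [Set.mem_iUnion] at hx
  obtain ⟨i, hi, hx⟩ := hx
  have : (x : R[X]).coeff 0 = 0 := hx 0 (by omega)
  simp [symbolicReesMaximalIdeal, symbolicReesConstantCoeff_apply, this]

theorem symbolicReesMaximalIdeal_le {P : Ideal I.symbolicReesAlgebra}
    (h1 : I.symbolicFiberIdeal ≤ P)
    (h2 : (HomogeneousIdeal.irrelevant I.symbolicReesPiece).toIdeal ≤ P) :
    I.symbolicReesMaximalIdeal ≤ P := by
  classical
  intro f hf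
  rw [← DirectSum.sum_support_decompose I.symbolicReesPiece f]
  refine Ideal.sum_mem _ fun i _ => ?_
  rcases Nat.eq_zero_or_pos i with rfl | hi
  · refine h1 ?_
    rw [I.eq_algebraMap_of_mem_symbolicReesPiece_zero (SetLike.coe_mem _),
      decompose_symbolicReesPiece, coe_symbolicReesComponent, coeff_monomial, if_pos rfl]
    exact mem_map_of_mem _ hf
  · exact h2 (HomogeneousIdeal.mem_irrelevant_of_mem _ hi (SetLike.coe_mem _))

/-- An element outside the maximal ideal has a unit as degree zero component, and a homogeneous `P`
contains that component. -/
theorem le_symbolicReesMaximalIdeal {P : Ideal I.symbolicReesAlgebra} (hP : P ≠ ⊤)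
    (hPh : P.IsHomogeneous I.symbolicReesPiece) : P ≤ I.symbolicReesMaximalIdeal := by
  intro f hf
  by_contra hcon
  refine hP ?_
  have hu : IsUnit ((f : R[X]).coeff 0) := by
    by_contra h
    exact hcon ((IsLocalRing.mem_maximalIdeal _).mpr h)
  refine eq_top_of_isUnit_mem _ (hPh 0 hf) ?_
  rw [I.eq_algebraMap_of_mem_symbolicReesPiece_zero (SetLike.coe_mem _)]
  refine IsUnit.map _ ?_
  rwa [decompose_symbolicReesPiece, coe_symbolicReesComponent, coeff_monomial, if_pos rfl]

end Local

end Ideal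

/-! ### Counting generators: arithmetic rank and the upper growth bound. -/

theorem Submodule.FG.spanFinrank_sup_le {R M : Type*} [Ring R] [AddCommGroup M] [Module R M]
    {p q : Submodule R M} (hp : p.FG) (hq : q.FG) :
    (p ⊔ q).spanFinrank ≤ p.spanFinrank + q.spanFinrank := by
  have h := Submodule.spanRank_sup_le_sum_spanRank (p := p) (q := q)
  rw [hp.spanRank_eq_spanFinrank, hq.spanRank_eq_spanFinrank,
    (hp.sup hq).spanRank_eq_spanFinrank] at h
  exact_mod_cast h

theorem Nat.multichoose_succ_le_pow (d q : ℕ) : Nat.multichoose (d + 1) q ≤ (q + 1) ^ d := by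
  induction d generalizing q with
  | zero => simp
  | succ d ih =>
    induction q with
    | zero => simp
    | succ q ihq =>
      rw [Nat.multichoose_succ_succ]
      calc Nat.multichoose (d + 1) (q + 1) + Nat.multichoose (d + 1 + 1) q
          ≤ (q + 1 + 1) ^ d + (q + 1) ^ (d + 1) := add_le_add (ih _) ihq
        _ ≤ (q + 1 + 1) ^ d + (q + 1 + 1) ^ d * (q + 1) := by
            rw [pow_succ]
            gcongr
            omega
        _ = (q + 1 + 1) ^ (d + 1) := by ring

namespace Ideal

section Generators

variable {R : Type*} [CommRing R]

/-- For principal `J` this is the ideal-theoretic form of Pascal's rule for `Nat.multichoose`: a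
product of `q + 1` factors either uses `J` or lies in `L ^ (q + 1)`. -/
theorem sup_pow_succ (J L : Ideal R) (q : ℕ) :
    (J ⊔ L) ^ (q + 1) = J * (J ⊔ L) ^ q ⊔ L ^ (q + 1) := by
  refine le_antisymm ?_ (sup_le ?_ (pow_right_mono le_sup_right _))
  · induction q with
    | zero => simp
    | succ q ih =>
      rw [pow_succ' (J ⊔ L), sup_mul]
      refine sup_le le_sup_left ?_
      refine (mul_mono_right ih).trans ?_
      rw [mul_sup, pow_succ' L (q + 1)]
      refine sup_le_sup_right ?_ _
      rw [mul_left_comm]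
      refine mul_mono_right ?_
      rw [pow_succ' (J ⊔ L)]
      exact mul_mono_left le_sup_right
  · rw [pow_succ']
    exact mul_mono_left le_sup_left

variable [IsNoetherianRing R]

theorem minGenerators_span_singleton_mul_le (a : R) (L : Ideal R) :
    (span {a} * L).minGenerators ≤ L.minGenerators := by
  have : span {a} * L = Submodule.map (LinearMap.mulLeft R a) L := by
    ext x
    rw [mem_span_singleton_mul]
    rfl
  rw [this]
  exact Submodule.spanFinrank_map_le_of_fg _ (IsNoetherian.noetherian L)

theorem minGenerators_sup_le (J L : Ideal R) :
    (J ⊔ L).minGenerators ≤ J.minGenerators + L.minGenerators :=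
  Submodule.FG.spanFinrank_sup_le (IsNoetherian.noetherian J) (IsNoetherian.noetherian L)

theorem minGenerators_span_range_pow_mul_le {d : ℕ} (g : Fin d → R) (q : ℕ) (L : Ideal R) :
    (span (Set.range g) ^ q * L).minGenerators ≤ Nat.multichoose d q * L.minGenerators := by
  induction d generalizing q with
  | zero =>
    cases q with
    | zero => simp
    | succ q => simp [minGenerators, pow_succ]
  | succ d ih =>
    induction q with
    | zero => simp
    | succ q ihq =>
      have hg : span (Set.range g) = span {g 0} ⊔ span (Set.range (Fin.tail g)) := by
        conv_lhs => rw [← Fin.cons_self_tail g]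
        rw [Fin.range_cons, Set.insert_eq, span_union]
      rw [hg] at ihq ⊢
      rw [sup_pow_succ, sup_mul, Nat.multichoose_succ_succ, add_comm (Nat.multichoose _ _),
        add_mul, mul_assoc]
      refine (minGenerators_sup_le _ _).trans (add_le_add ?_ (ih _ _))
      exact (minGenerators_span_singleton_mul_le _ _).trans ihq

end Generators

section Local

variable {R : Type*} [CommRing R] [IsLocalRing R] (I : Ideal R)

theorem symbolicFiberIdeal_isHomogeneous :
    I.symbolicFiberIdeal.IsHomogeneous I.symbolicReesPiece := by
  refine homogeneous_span _ _ ?_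
  rintro _ ⟨r, -, rfl⟩
  exact ⟨0, SetLike.algebraMap_mem_graded I.symbolicReesPiece r⟩

variable [IsNoetherianRing R]

/-- Parameters of the fiber cone generate all its pieces of large degree, so the equality holds
modulo `m I^(n)`; Nakayama removes the error. The condition `n₀ ≥ N` makes `n - N` a genuine
difference. -/
theorem exists_symbolicPower_eq_mul (hnoeth : IsNoetherianRing I.symbolicReesAlgebra) {d : ℕ}
    (hd : ringKrullDim (I.symbolicReesAlgebra ⧸ I.symbolicFiberIdeal) ≤ d) :
    ∃ N > 0, ∃ g : Fin d → R, (∀ i, g i ∈ I.symbolicPower N) ∧ ∃ n₀ ≥ N, ∀ n ≥ n₀,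
      I.symbolicPower n = span (Set.range g) * I.symbolicPower (n - N) := by
  obtain ⟨N, hN, g, hg, hle⟩ :=
    GradedAlgebra.exists_irrelevant_le_radical_of_same_degree I.symbolicReesPiece
      I.symbolicReesMaximalIdeal I.irrelevant_le_symbolicReesMaximalIdeal d I.symbolicFiberIdeal
      I.symbolicFiberIdeal_isHomogeneous
      (fun P hP hPh _ => I.le_symbolicReesMaximalIdeal hP.ne_top hPh)
      (fun P h1 h2 => I.symbolicReesMaximalIdeal_le h1 h2) hd
  obtain ⟨n₀, hn₀⟩ := GradedAlgebra.exists_forall_mem_of_irrelevant_le_radical _ hle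
  refine ⟨N, hN, fun i => (g i : R[X]).coeff N, fun i => (g i).2 N, max n₀ N, le_max_right _ _,
    fun n hn => le_antisymm ?_ ?_⟩
  · refine Submodule.le_of_le_smul_of_le_jacobson_bot (I := IsLocalRing.maximalIdeal R)
      (IsNoetherian.noetherian _) (IsLocalRing.maximalIdeal_le_jacobson _) ?_
    intro a ha
    have h1 := hn₀ n ((le_max_left _ _).trans hn) _ (I.symbolicReesMonomial_mem n ⟨a, ha⟩)
    obtain ⟨u, hu, v, hv, huv⟩ := Submodule.mem_sup.mp h1
    have h2 : a = (v : R[X]).coeff n + (u : R[X]).coeff n := by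
      have h3 := congrArg (fun f : I.symbolicReesAlgebra => (f : R[X]).coeff n) huv
      simp only [coe_symbolicReesMonomial, coeff_monomial, if_true] at h3
      rw [← h3, add_comm]
      simp
    rw [h2]
    exact add_mem (Submodule.mem_sup_left
      (I.coeff_mem_of_mem_span hg hv ((le_max_right _ _).trans hn)))
      (Submodule.mem_sup_right (I.coeff_mem_of_mem_map hu n))
  · have hN' : N ≤ n := (le_max_right _ _).trans hn
    calc span (Set.range fun i => (g i : R[X]).coeff N) * I.symbolicPower (n - N)
        ≤ I.symbolicPower N * I.symbolicPower (n - N) := by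
          refine mul_mono_left (span_le.mpr ?_)
          rintro _ ⟨i, rfl⟩
          exact (g i).2 N
      _ ≤ I.symbolicPower (N + (n - N)) := I.symbolicPower_mul_le _ _
      _ = I.symbolicPower n := by rw [Nat.add_sub_cancel' hN']

theorem arithmeticRank_le_of_ringKrullDim_le (hnoeth : IsNoetherianRing I.symbolicReesAlgebra)
    {d : ℕ} (hd : ringKrullDim (I.symbolicReesAlgebra ⧸ I.symbolicFiberIdeal) ≤ d) :
    I.arithmeticRank ≤ d := by
  obtain ⟨N, hN, g, hg, n₀, hn₀, h⟩ := I.exists_symbolicPower_eq_mul hnoeth hd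
  refine Nat.sInf_le ⟨g, le_antisymm ?_ ?_⟩
  · rw [radical_le_radical_iff, span_le]
    rintro _ ⟨i, rfl⟩
    exact I.symbolicPower_le_radical hN (hg i)
  · rw [radical_le_radical_iff]
    intro a ha
    refine ⟨n₀, ?_⟩
    have h1 := I.pow_le_symbolicPower n₀ (pow_mem_pow ha n₀)
    rw [h n₀ le_rfl] at h1
    exact (mul_le_inf h1).1

theorem natCast_mem_growthExponents (hnoeth : IsNoetherianRing I.symbolicReesAlgebra)
    {d : ℕ} (hd : ringKrullDim (I.symbolicReesAlgebra ⧸ I.symbolicFiberIdeal) ≤ d) :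
    (d : ℝ) ∈ growthExponents I.symbolicPower := by
  obtain ⟨N, hN, g, hg, n₀, hn₀, h⟩ := I.exists_symbolicPower_eq_mul hnoeth hd
  have hpow : ∀ q n, n₀ ≤ n →
      I.symbolicPower (n + q * N) = span (Set.range g) ^ q * I.symbolicPower n := by
    intro q n hn
    induction q with
    | zero => simp
    | succ q ih =>
      rw [h _ (hn.trans (Nat.le_add_right _ _)), pow_succ', mul_assoc, ← ih]
      congr 2
      rw [add_mul, one_mul, ← add_assoc, Nat.add_sub_cancel]
  -- The largest generator number in one period of residues modulo `N`.
  set C := (Finset.range N).sup fun r => (I.symbolicPower (n₀ + r)).minGenerators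
  have hbound : ∀ n ≥ n₀, (I.symbolicPower n).minGenerators ≤
      Nat.multichoose d ((n - n₀) / N) * C := by
    intro n hn
    have hn' : n = n₀ + (n - n₀) % N + (n - n₀) / N * N := by
      have := Nat.mod_add_div' (n - n₀) N
      omega
    conv_lhs => rw [hn', hpow _ _ (by omega)]
    refine (minGenerators_span_range_pow_mul_le _ _ _).trans (Nat.mul_le_mul_left _ ?_)
    exact Finset.le_sup (f := fun r => (I.symbolicPower (n₀ + r)).minGenerators)
      (Finset.mem_range.mpr (Nat.mod_lt _ hN))
  refine ⟨Nat.cast_nonneg _, ?_⟩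
  -- For `d = 0` the exponent is `-1`, but `Nat.multichoose 0 q = 0` for `q > 0`, so the generator
  -- numbers vanish eventually.
  rcases d with _ | d
  · refine (isBigO_zero _ _).congr' ?_ EventuallyEq.rfl
    filter_upwards [eventually_ge_atTop (n₀ + N)] with n hn
    have h1 := hbound n (by omega)
    have h2 : 0 < (n - n₀) / N := Nat.div_pos (by omega) hN
    obtain ⟨q, hq⟩ := Nat.exists_eq_succ_of_ne_zero h2.ne'
    rw [hq, Nat.succ_eq_add_one, Nat.multichoose_zero_succ, zero_mul] at h1
    simp [Nat.le_zero.mp h1]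
  · refine IsBigO.of_bound (2 ^ d * C) ?_
    filter_upwards [eventually_ge_atTop (max n₀ 1)] with n hn
    have hn1 : n₀ ≤ n := (le_max_left _ _).trans hn
    have hn2 : 1 ≤ n := (le_max_right _ _).trans hn
    have h1 : (I.symbolicPower n).minGenerators ≤ 2 ^ d * C * n ^ d := by
      refine (hbound n hn1).trans ?_
      calc Nat.multichoose (d + 1) ((n - n₀) / N) * C
          ≤ ((n - n₀) / N + 1) ^ d * C := Nat.mul_le_mul_right _ (Nat.multichoose_succ_le_pow _ _)
        _ ≤ (2 * n) ^ d * C := by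
          -- Since `n ≥ 1`, the base is at most `n + 1 ≤ 2 * n`.
          gcongr
          have := Nat.div_le_self (n - n₀) N
          omega
        _ = 2 ^ d * C * n ^ d := by rw [mul_pow]; ring
    have h2 : (n : ℝ) ^ (((d + 1 : ℕ) : ℝ) - 1) = (n : ℝ) ^ d := by
      rw [← Real.rpow_natCast]
      congr 1
      push_cast
      ring
    rw [h2, Real.norm_of_nonneg (by positivity), Real.norm_of_nonneg (by positivity)]
    exact_mod_cast h1

end Local

end Ideal

/-! ### Lengths along chains of primes: the lower growth bound. -/

section Length

variable {R M : Type*} [CommRing R] [AddCommGroup M] [Module R M]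

theorem Submodule.length_sup_le (p q : Submodule R M) :
    Module.length R (p ⊔ q : Submodule R M) ≤ Module.length R p + Module.length R q := by
  rw [Submodule.sup_eq_range, ← Module.length_prod]
  exact Module.length_le_of_surjective _ (LinearMap.surjective_rangeRestrict _)

theorem Submodule.length_span_singleton_le_one {m : Ideal R} [hm : m.IsMaximal] {x : M}
    (hx : ∀ r ∈ m, r • x = 0) : Module.length R (R ∙ x) ≤ 1 := by
  have : IsSimpleModule R (R ⧸ m) := isSimpleModule_iff_isCoatom.mpr hm.out
  rw [← Module.length_eq_one (R := R) (M := R ⧸ m), LinearMap.span_singleton_eq_range]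
  have hle : m ≤ LinearMap.ker (LinearMap.toSpanSingleton R M x).rangeRestrict := by
    intro r hr
    rw [LinearMap.ker_rangeRestrict]
    exact hx r hr
  refine Module.length_le_of_surjective (Submodule.liftQ m _ hle) ?_
  rw [← LinearMap.range_eq_top, Submodule.range_liftQ, LinearMap.range_eq_top]
  exact LinearMap.surjective_rangeRestrict _

/-- A finitely generated module killed by a maximal ideal has length at most its number of
generators. -/
theorem Submodule.length_le_spanFinrank {m : Ideal R} [m.IsMaximal] {p : Submodule R M}
    (hp : p.FG) (hm : ∀ r ∈ m, ∀ x ∈ p, r • x = 0) :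
    Module.length R p ≤ p.spanFinrank := by
  obtain ⟨s, hs, hsp⟩ := hp.exists_span_finset_card_eq_spanFinrank
  rw [← hs]
  have hms : ∀ r ∈ m, ∀ x ∈ s, r • x = 0 := fun r hr x hx =>
    hm r hr x (hsp ▸ Submodule.subset_span hx)
  clear hs
  subst hsp
  clear hp hm
  classical
  induction s using Finset.induction_on with
  | empty =>
    rw [Finset.coe_empty, Submodule.span_empty]
    simp
  | insert x s hx ih =>
    rw [Finset.coe_insert, Submodule.span_insert, Finset.card_insert_of_notMem hx, add_comm]
    push_cast
    refine (Submodule.length_sup_le _ _).trans (add_le_add ?_ ?_)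
    · exact Submodule.length_span_singleton_le_one (m := m)
        fun r hr => hms r hr x (Finset.mem_insert_self x s)
    · exact ih fun r hr y hy => hms r hr y (Finset.mem_insert_of_mem hy)

/-- The map `f` embeds `r` into the kernel of `π` restricted to `p`, and length is additive. -/
theorem Submodule.length_map_add_length_le {M' : Type*} [AddCommGroup M'] [Module R M']
    (p r : Submodule R M) (π : M →ₗ[R] M') (f : M →ₗ[R] M) (hf : Function.Injective f)
    (hmem : ∀ x ∈ r, f x ∈ p) (hπ : ∀ x, π (f x) = 0) :
    Module.length R (p.map π) + Module.length R r ≤ Module.length R p := by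
  let φ := π ∘ₗ p.subtype
  have hrange : LinearMap.range φ = p.map π := by
    rw [LinearMap.range_comp, Submodule.range_subtype]
  have hlen := Module.length_eq_add_of_exact (LinearMap.ker φ).subtype φ.rangeRestrict
    (Submodule.subtype_injective _) φ.surjective_rangeRestrict (by
      rw [LinearMap.exact_iff, LinearMap.ker_rangeRestrict, Submodule.range_subtype])
  rw [hlen, hrange, add_comm]
  refine add_le_add_left ?_ _
  let ψ : r →ₗ[R] p := f.restrict hmem
  refine Module.length_le_of_injective (ψ.codRestrict (LinearMap.ker φ) fun x => hπ x) ?_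
  intro x y hxy
  exact Subtype.ext (hf (congrArg (fun z : LinearMap.ker φ => ((z : p) : M)) hxy))

end Length

namespace Ideal

variable {R : Type*} [CommRing R] (I : Ideal R)

/-- The elements of degree at most `n` of the symbolic Rees algebra. -/
def symbolicReesLE (n : ℕ) : Submodule R I.symbolicReesAlgebra where
  carrier := {f | ∀ k, n < k → (f : R[X]).coeff k = 0}
  add_mem' hf hg k hk := by simp [hf k hk, hg k hk]
  zero_mem' k _ := by simp
  smul_mem' r f hf k hk := by simp [hf k hk]

theorem symbolicReesLE_mono {m n : ℕ} (h : m ≤ n) : I.symbolicReesLE m ≤ I.symbolicReesLE n :=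
  fun _ hf k hk => hf k (h.trans_lt hk)

theorem exists_mem_symbolicReesLE (f : I.symbolicReesAlgebra) : ∃ n, f ∈ I.symbolicReesLE n :=
  ⟨(f : R[X]).natDegree, fun _ hk => coeff_eq_zero_of_natDegree_lt hk⟩

theorem mul_mem_symbolicReesLE {m n : ℕ} {f g : I.symbolicReesAlgebra}
    (hf : f ∈ I.symbolicReesLE m) (hg : g ∈ I.symbolicReesLE n) :
    f * g ∈ I.symbolicReesLE (m + n) := by
  intro k hk
  have h1 : (f : R[X]).natDegree ≤ m := natDegree_le_iff_coeff_eq_zero.mpr hf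
  have h2 : (g : R[X]).natDegree ≤ n := natDegree_le_iff_coeff_eq_zero.mpr hg
  exact coeff_eq_zero_of_natDegree_lt
    (lt_of_le_of_lt (natDegree_mul_le.trans (add_le_add h1 h2)) hk)

theorem symbolicReesLE_zero : I.symbolicReesLE 0 = I.symbolicReesPiece 0 := by
  ext f
  exact forall_congr' fun k => by rw [pos_iff_ne_zero]

theorem symbolicReesLE_succ (n : ℕ) :
    I.symbolicReesLE (n + 1) = I.symbolicReesLE n ⊔ I.symbolicReesPiece (n + 1) := by
  refine le_antisymm ?_ (sup_le (I.symbolicReesLE_mono n.le_succ) ?_)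
  · intro f hf
    rw [← sub_add_cancel f (I.symbolicReesComponent (n + 1) f : I.symbolicReesAlgebra)]
    refine Submodule.add_mem_sup ?_ (SetLike.coe_mem _)
    intro k hk
    rcases (Nat.succ_le_of_lt hk).eq_or_lt with rfl | hlt
    · simp [coe_symbolicReesComponent]
    · simp [coe_symbolicReesComponent, coeff_monomial, hf k hlt, hlt.ne]
  · exact fun f hf k hk => hf k hk.ne'

section Noetherian

variable [IsNoetherianRing R]

theorem symbolicReesPiece_fg (n : ℕ) : (I.symbolicReesPiece n).FG := by
  rw [symbolicReesPiece_eq_range, LinearMap.range_eq_map]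
  exact (IsNoetherian.noetherian _).map _

theorem spanFinrank_symbolicReesPiece_le (n : ℕ) :
    (I.symbolicReesPiece n).spanFinrank ≤ (I.symbolicPower n).minGenerators := by
  rw [symbolicReesPiece_eq_range, LinearMap.range_eq_map, minGenerators,
    ← Submodule.spanFinrank_top (I.symbolicPower n)]
  exact Submodule.spanFinrank_map_le_of_fg _ (IsNoetherian.noetherian _)

theorem symbolicReesLE_fg_and_spanFinrank_le (n : ℕ) : (I.symbolicReesLE n).FG ∧
    (I.symbolicReesLE n).spanFinrank ≤
      ∑ i ∈ Finset.range (n + 1), (I.symbolicPower i).minGenerators := by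
  induction n with
  | zero =>
    rw [symbolicReesLE_zero]
    exact ⟨I.symbolicReesPiece_fg 0, by simpa using I.spanFinrank_symbolicReesPiece_le 0⟩
  | succ n ih =>
    rw [symbolicReesLE_succ, Finset.sum_range_succ]
    exact ⟨ih.1.sup (I.symbolicReesPiece_fg _), (ih.1.spanFinrank_sup_le
      (I.symbolicReesPiece_fg _)).trans (add_le_add ih.2 (I.spanFinrank_symbolicReesPiece_le _))⟩

end Noetherian

/-- The image of the elements of degree at most `n` in a quotient of the symbolic Rees algebra. -/
noncomputable def symbolicReesLEQuotient (P : Ideal I.symbolicReesAlgebra) (n : ℕ) :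
    Submodule R (I.symbolicReesAlgebra ⧸ P) :=
  (I.symbolicReesLE n).map (Ideal.Quotient.mkₐ R P).toLinearMap

theorem mk_mem_symbolicReesLEQuotient (P : Ideal I.symbolicReesAlgebra) {n : ℕ}
    {f : I.symbolicReesAlgebra} (hf : f ∈ I.symbolicReesLE n) :
    Ideal.Quotient.mk P f ∈ I.symbolicReesLEQuotient P n := ⟨f, hf, rfl⟩

theorem one_le_length_symbolicReesLEQuotient {P : Ideal I.symbolicReesAlgebra} (hP : P ≠ ⊤)
    (n : ℕ) : 1 ≤ Module.length R (I.symbolicReesLEQuotient P n) := by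
  rw [Order.one_le_iff_pos, Module.length_pos_iff]
  have h1 : (1 : I.symbolicReesAlgebra) ∈ I.symbolicReesLE n := by
    intro k hk
    simp [coeff_one, (Nat.zero_le n).trans_lt hk |>.ne']
  refine ⟨⟨_, I.mk_mem_symbolicReesLEQuotient P h1⟩, 0, fun h => hP ?_⟩
  rw [eq_top_iff_one, ← Ideal.Quotient.eq_zero_iff_mem]
  exact congrArg Subtype.val h

/-- Multiplication by `g` is injective modulo the prime `P`, zero modulo `Q`, and raises degrees by
at most `N`. Filtering by degree instead of grading lets `P`, `Q` and `g` be inhomogeneous. -/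
theorem length_symbolicReesLEQuotient_add_le {P Q : Ideal I.symbolicReesAlgebra}
    (hP : P.IsPrime) (hPQ : P ≤ Q) {N : ℕ} {g : I.symbolicReesAlgebra}
    (hg : g ∈ I.symbolicReesLE N) (hgQ : g ∈ Q) (hgP : g ∉ P) (n : ℕ) :
    Module.length R (I.symbolicReesLEQuotient Q (n + N)) +
      Module.length R (I.symbolicReesLEQuotient P n) ≤
    Module.length R (I.symbolicReesLEQuotient P (n + N)) := by
  let π : (I.symbolicReesAlgebra ⧸ P) →ₗ[R] (I.symbolicReesAlgebra ⧸ Q) :=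
    (Ideal.Quotient.factorₐ R hPQ).toLinearMap
  have hrange : (I.symbolicReesLEQuotient P (n + N)).map π =
      I.symbolicReesLEQuotient Q (n + N) := by
    rw [symbolicReesLEQuotient, symbolicReesLEQuotient, ← Submodule.map_comp]
    rfl
  rw [← hrange]
  refine Submodule.length_map_add_length_le _ _ π
    (LinearMap.mulLeft R (Ideal.Quotient.mk P g)) ?_ ?_ ?_
  · intro x y hxy
    exact mul_left_cancel₀ (fun h => hgP (Ideal.Quotient.eq_zero_iff_mem.mp h)) hxy
  · rintro _ ⟨f, hf, rfl⟩
    rw [add_comm]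
    exact I.mk_mem_symbolicReesLEQuotient P (I.mul_mem_symbolicReesLE hg hf)
  · intro x
    change Ideal.Quotient.factor hPQ (Ideal.Quotient.mk P g * x) = 0
    rw [map_mul, Ideal.Quotient.factor_mk, Ideal.Quotient.eq_zero_iff_mem.mpr hgQ, zero_mul]

/-- A chain of `e + 1` primes forces growth of order at least `e`. -/
theorem exists_multichoose_le_length (e : ℕ) (P : Fin (e + 1) → Ideal I.symbolicReesAlgebra)
    (hP : ∀ i, (P i).IsPrime) (hmono : StrictMono P) :
    ∃ N₀, ∀ N ≥ N₀, ∀ q, (Nat.multichoose (e + 1) q : ℕ∞) ≤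
      Module.length R (I.symbolicReesLEQuotient (P 0) (q * N)) := by
  induction e with
  | zero =>
    refine ⟨0, fun N _ q => ?_⟩
    simpa using I.one_le_length_symbolicReesLEQuotient (hP 0).ne_top (q * N)
  | succ e ih =>
    obtain ⟨N₁, hN₁⟩ := ih (P ∘ Fin.succ) (fun i => hP _) (hmono.comp Fin.strictMono_succ)
    have hlt : P 0 < P 1 := hmono (by simp)
    obtain ⟨g, hg1, hg0⟩ := SetLike.exists_of_lt hlt
    obtain ⟨N₂, hN₂⟩ := I.exists_mem_symbolicReesLE g
    -- `N₁` serves the shortened chain; `N₂` bounds the degree of `g`.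
    refine ⟨max N₁ N₂, fun N hN q => ?_⟩
    have hgN := I.symbolicReesLE_mono ((le_max_right _ _).trans hN) hN₂
    induction q with
    | zero => simpa using I.one_le_length_symbolicReesLEQuotient (hP 0).ne_top (0 * N)
    | succ q ihq =>
      -- Pascal's rule matches the length inequality: the first summand is bounded by the quotient
      -- by `P 1`, the second by the quotient by `P 0` one step of `N` lower.
      rw [Nat.multichoose_succ_succ, add_mul, one_mul]
      push_cast
      refine le_trans (add_le_add ?_ ihq)
        (I.length_symbolicReesLEQuotient_add_le (hP 0) hlt.le hgN hg1 hg0 (q * N))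
      have := hN₁ N ((le_max_left _ _).trans hN) (q + 1)
      rw [add_mul, one_mul] at this
      exact this

theorem length_symbolicReesLEQuotient_le [IsLocalRing R] [IsNoetherianRing R]
    {P : Ideal I.symbolicReesAlgebra} (hP : I.symbolicFiberIdeal ≤ P) (n : ℕ) :
    Module.length R (I.symbolicReesLEQuotient P n) ≤
      (∑ i ∈ Finset.range (n + 1), (I.symbolicPower i).minGenerators : ℕ) := by
  obtain ⟨hfg, hle⟩ := I.symbolicReesLE_fg_and_spanFinrank_le n
  refine (Submodule.length_le_spanFinrank (m := IsLocalRing.maximalIdeal R) (hfg.map _) ?_).trans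
    (Nat.cast_le.mpr ((Submodule.spanFinrank_map_le_of_fg _ hfg).trans hle))
  rintro r hr _ ⟨f, hf, rfl⟩
  have h1 : algebraMap R I.symbolicReesAlgebra r * f ∈ P :=
    P.mul_mem_right _ (hP (mem_map_of_mem _ hr))
  rw [← map_smul, Algebra.smul_def]
  exact Ideal.Quotient.eq_zero_iff_mem.mpr h1

end Ideal

/-- Sums of a sequence of order `n ^ (t - 1)` cannot grow like a polynomial of degree exceeding
`t`. -/
theorem natCast_le_of_multichoose_le_sum {f : ℕ → ℕ} {t : ℝ} (ht : 0 ≤ t)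
    (hf : (fun n : ℕ => (f n : ℝ)) =O[atTop] fun n : ℕ => (n : ℝ) ^ (t - 1)) {e N : ℕ}
    (hN : 0 < N)
    (h : ∀ q, Nat.multichoose (e + 1) q ≤ ∑ i ∈ Finset.range (q * N + 1), f i) :
    (e : ℝ) ≤ t := by
  -- The multichoose number is `(q + e).choose e`, at least `(q + 1) ^ e / e!`.
  have hpow : ∀ q, (q + 1) ^ e ≤ e.factorial * ∑ i ∈ Finset.range (q * N + 1), f i := by
    intro q
    refine le_trans ?_ (Nat.mul_le_mul_left _ (h q))
    have h2 : Nat.multichoose (e + 1) q = (q + e).choose e := by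
      rw [Nat.multichoose_eq, show e + 1 + q - 1 = q + e by omega, Nat.choose_symm_add]
    rw [h2, ← Nat.descFactorial_eq_factorial_mul_choose]
    have h1 := Nat.pow_sub_le_descFactorial (q + e) e
    rwa [show q + e + 1 - e = q + 1 by omega] at h1
  by_contra! hlt
  -- For `t < 1` the natural numbers `f n` tend to zero, so they vanish eventually and their sums
  -- are bounded, against `e ≥ 1`.
  rcases lt_or_ge t 1 with ht1 | ht1
  · have he : 1 ≤ e := by
      by_contra! h0
      have : e = 0 := by omega
      subst this
      simp at hlt
      linarith
    have hlim : Tendsto (fun n : ℕ => (f n : ℝ)) atTop (nhds 0) := by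
      refine hf.trans_tendsto ?_
      have := (tendsto_rpow_neg_atTop (show 0 < 1 - t by linarith)).comp
        (tendsto_natCast_atTop_atTop (R := ℝ))
      simpa [Function.comp_def] using this
    obtain ⟨n₁, hn₁⟩ := eventually_atTop.mp (hlim.eventually (gt_mem_nhds one_pos))
    have hzero : ∀ n ≥ n₁, f n = 0 := fun n hn => by
      have := hn₁ n hn
      have : f n < 1 := by exact_mod_cast this
      omega
    have hsum : ∀ n, ∑ i ∈ Finset.range n, f i ≤ ∑ i ∈ Finset.range n₁, f i := by
      intro n
      rcases le_total n n₁ with hn | hn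
      · exact Finset.sum_le_sum_of_subset (Finset.range_mono hn)
      · refine (Finset.sum_subset (Finset.range_mono hn) fun i _ hi => hzero i ?_).ge
        simpa using hi
    -- With `q` equal to the bound itself, `(q + 1) ^ e ≥ q + 1` exceeds it.
    have h1 := hpow (e.factorial * ∑ i ∈ Finset.range n₁, f i)
    have h2 := Nat.mul_le_mul_left e.factorial
      (hsum (e.factorial * (∑ i ∈ Finset.range n₁, f i) * N + 1))
    have h3 := Nat.le_self_pow (show e ≠ 0 by omega)
      (e.factorial * ∑ i ∈ Finset.range n₁, f i + 1)
    omega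
  · obtain ⟨C, hC0, hC⟩ := hf.exists_pos
    obtain ⟨n₁, hn₁⟩ := eventually_atTop.mp hC.bound
    set B := ∑ i ∈ Finset.range n₁, f i
    -- As `t ≥ 1`, the power is monotone and at least one; `B` absorbs the terms before `n₁`.
    have hterm : ∀ n ≥ 1, ∀ i ≤ n, (f i : ℝ) ≤ (C + B) * (n : ℝ) ^ (t - 1) := by
      intro n hn i hi
      have hone : (1 : ℝ) ≤ (n : ℝ) ^ (t - 1) :=
        Real.one_le_rpow (by exact_mod_cast hn) (by linarith)
      rcases lt_or_ge i n₁ with hlt | hge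
      · have h1 : f i ≤ B := Finset.single_le_sum (f := f) (fun _ _ => Nat.zero_le _)
          (Finset.mem_range.mpr hlt)
        have h2 : (f i : ℝ) ≤ B := by exact_mod_cast h1
        nlinarith
      · have h1 := hn₁ i hge
        rw [Real.norm_of_nonneg (by positivity), Real.norm_of_nonneg (by positivity)] at h1
        have h2 : (i : ℝ) ^ (t - 1) ≤ (n : ℝ) ^ (t - 1) :=
          Real.rpow_le_rpow (by positivity) (by exact_mod_cast hi) (by linarith)
        have h3 : (0 : ℝ) ≤ B := by positivity
        nlinarith
    -- This bound on `q ^ (e - t)`, uniform in `q`, contradicts `e > t`.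
    have hmain : ∀ q : ℕ, 1 ≤ q →
        (q : ℝ) ^ ((e : ℝ) - t) ≤ e.factorial * (2 * (C + B) * (N : ℝ) ^ t) := by
      intro q hq
      have hq0 : (0 : ℝ) < q := by exact_mod_cast hq
      have hqN : 1 ≤ q * N := Nat.mul_pos hq hN
      have h1 : ((∑ i ∈ Finset.range (q * N + 1), f i : ℕ) : ℝ) ≤
          (q * N + 1 : ℕ) * ((C + B) * ((q * N : ℕ) : ℝ) ^ (t - 1)) := by
        push_cast
        have h2 := Finset.sum_le_card_nsmul (Finset.range (q * N + 1)) (fun i => (f i : ℝ))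
          ((C + B) * ((q * N : ℕ) : ℝ) ^ (t - 1))
          (fun i hi => hterm _ hqN i (by simpa [Nat.lt_succ_iff] using hi))
        simpa using h2
      have h3 : ((q * N + 1 : ℕ) : ℝ) * ((C + B) * ((q * N : ℕ) : ℝ) ^ (t - 1)) ≤
          2 * (C + B) * ((q * N : ℕ) : ℝ) ^ t := by
        have h4 : ((q * N : ℕ) : ℝ) ^ t = ((q * N : ℕ) : ℝ) ^ (t - 1) * ((q * N : ℕ) : ℝ) := by
          rw [← Real.rpow_add_one (by positivity), sub_add_cancel]
        have h5 : ((q * N + 1 : ℕ) : ℝ) ≤ 2 * ((q * N : ℕ) : ℝ) := by exact_mod_cast (by omega)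
        calc ((q * N + 1 : ℕ) : ℝ) * ((C + B) * ((q * N : ℕ) : ℝ) ^ (t - 1))
            ≤ (2 * ((q * N : ℕ) : ℝ)) * ((C + B) * ((q * N : ℕ) : ℝ) ^ (t - 1)) := by
              gcongr
          _ = 2 * (C + B) * ((q * N : ℕ) : ℝ) ^ t := by rw [h4]; ring
      have h6 : (q : ℝ) ^ (e : ℝ) ≤
          e.factorial * (2 * (C + B) * (N : ℝ) ^ t) * (q : ℝ) ^ t := by
        have h7 : ((q : ℝ) + 1) ^ e ≤
            e.factorial * ((∑ i ∈ Finset.range (q * N + 1), f i : ℕ) : ℝ) := by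
          exact_mod_cast hpow q
        have h8 : (q : ℝ) ^ e ≤ ((q : ℝ) + 1) ^ e := by gcongr; linarith
        have h9 : ((q * N : ℕ) : ℝ) ^ t = (q : ℝ) ^ t * (N : ℝ) ^ t := by
          push_cast
          exact Real.mul_rpow (by positivity) (by positivity)
        rw [Real.rpow_natCast]
        calc (q : ℝ) ^ e ≤ e.factorial * ((∑ i ∈ Finset.range (q * N + 1), f i : ℕ) : ℝ) :=
              h8.trans h7
          _ ≤ e.factorial * (2 * (C + B) * ((q * N : ℕ) : ℝ) ^ t) := by
              gcongr
              exact h1.trans h3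
          _ = _ := by rw [h9]; ring
      rw [Real.rpow_sub hq0, div_le_iff₀ (by positivity)]
      exact h6
    have hlim : Tendsto (fun q : ℕ => (q : ℝ) ^ ((e : ℝ) - t)) atTop atTop :=
      (tendsto_rpow_atTop (by linarith)).comp tendsto_natCast_atTop_atTop
    obtain ⟨q, hq1, hq2⟩ := ((hlim.eventually_gt_atTop
      (e.factorial * (2 * (C + B) * (N : ℝ) ^ t))).and (eventually_ge_atTop 1)).exists
    exact absurd (hmain q hq2) (not_le.mpr hq1)

namespace Ideal

theorem natCast_le_of_mem_growthExponents {R : Type*} [CommRing R] [IsLocalRing R]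
    [IsNoetherianRing R] (I : Ideal R) {e : ℕ}
    (he : (e : WithBot ℕ∞) ≤ ringKrullDim (I.symbolicReesAlgebra ⧸ I.symbolicFiberIdeal))
    {t : ℝ} (ht : t ∈ growthExponents I.symbolicPower) : (e : ℝ) ≤ t := by
  rw [ringKrullDim_quotient] at he
  obtain ⟨p, hp⟩ := Order.le_krullDim_iff.mp he
  have hmono : StrictMono fun i : Fin (e + 1) => (p (Fin.cast (by rw [hp]) i)).1.asIdeal := by
    intro i j hij
    exact p.strictMono (by simpa using hij)
  obtain ⟨N₀, hN₀⟩ := I.exists_multichoose_le_length e _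
    (fun i => (p (Fin.cast (by rw [hp]) i)).1.2) hmono
  refine natCast_le_of_multichoose_le_sum ht.1 ht.2 (Nat.succ_pos N₀) fun q => ?_
  have h1 := hN₀ (N₀ + 1) (Nat.le_succ _) q
  exact_mod_cast h1.trans (I.length_symbolicReesLEQuotient_le (p _).2 _)

end Ideal

/-! ### Dimension of algebras generated by monomials. -/

section Dimension

/-- Adjoining an algebraic element to a Noetherian domain does not increase the dimension. -/
theorem ringKrullDim_le_of_surjective_polynomial {S S' : Type*} [CommRing S] [IsDomain S]
    [IsNoetherianRing S] [CommRing S'] (f : S[X] →+* S') (hf : Function.Surjective f)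
    {p : S[X]} (hp : p ≠ 0) (hfp : f p = 0) : ringKrullDim S' ≤ ringKrullDim S := by
  have h := ringKrullDim_succ_le_of_surjective f hf (mem_nonZeroDivisors_of_ne_zero hp) hfp
  rw [Polynomial.ringKrullDim_of_isNoetherianRing] at h
  exact ENat.WithBot.add_le_add_one_right_iff.mp h

/-- Evaluation of polynomials over `B[T]` at `x` as a map onto `B[T, x]`. -/
noncomputable def Algebra.adjoinInsertEval {B D : Type*} [CommRing B] [CommRing D] [Algebra B D]
    (T : Set D) (x : D) :
    (Algebra.adjoin B T)[X] →+* Algebra.adjoin B (insert x T) :=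
  eval₂RingHom (Subalgebra.inclusion (Algebra.adjoin_mono (Set.subset_insert x T))).toRingHom
    ⟨x, Algebra.subset_adjoin (Set.mem_insert x T)⟩

theorem Algebra.adjoinInsertEval_C {B D : Type*} [CommRing B] [CommRing D] [Algebra B D]
    (T : Set D) (x : D) (a : Algebra.adjoin B T) :
    Algebra.adjoinInsertEval T x (C a) =
      Subalgebra.inclusion (Algebra.adjoin_mono (Set.subset_insert x T)) a :=
  eval₂_C _ _

theorem Algebra.adjoinInsertEval_X {B D : Type*} [CommRing B] [CommRing D] [Algebra B D]
    (T : Set D) (x : D) :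
    Algebra.adjoinInsertEval (B := B) T x X =
      ⟨x, Algebra.subset_adjoin (Set.mem_insert x T)⟩ :=
  eval₂_X _ _

theorem Algebra.adjoinInsertEval_surjective {B D : Type*} [CommRing B] [CommRing D] [Algebra B D]
    (T : Set D) (x : D) : Function.Surjective (Algebra.adjoinInsertEval (B := B) T x) := by
  rintro ⟨y, hy⟩
  induction hy using Algebra.adjoin_induction with
  | mem z hz =>
    rcases hz with rfl | hz
    · exact ⟨X, adjoinInsertEval_X _ _⟩
    · exact ⟨C ⟨z, Algebra.subset_adjoin hz⟩, adjoinInsertEval_C _ _ _⟩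
  | algebraMap b => exact ⟨C (algebraMap B _ b), adjoinInsertEval_C _ _ _⟩
  | add u v _ _ hu hv =>
    obtain ⟨p, hp⟩ := hu
    obtain ⟨q, hq⟩ := hv
    exact ⟨p + q, by rw [map_add, hp, hq]; rfl⟩
  | mul u v _ _ hu hv =>
    obtain ⟨p, hp⟩ := hu
    obtain ⟨q, hq⟩ := hv
    exact ⟨p * q, by rw [map_mul, hp, hq]; rfl⟩

/-- An algebra generated by finitely many monomials of `B[t]`, one of which is nonconstant, has
dimension at most `dim B + 1`. -/
theorem ringKrullDim_adjoin_monomials_le {B : Type*} [CommRing B] [IsDomain B]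
    [IsNoetherianRing B] {n : ℕ} (hn : 0 < n) {a : B} (ha : a ≠ 0) (T : Finset B[X])
    (hT : ∀ x ∈ T, ∃ k b, x = monomial k b) :
    ringKrullDim (Algebra.adjoin B (insert (monomial n a) (T : Set B[X]))) ≤
      ringKrullDim B + 1 := by
  classical
  induction T using Finset.induction_on with
  | empty =>
    rw [← Polynomial.ringKrullDim_of_isNoetherianRing]
    refine ringKrullDim_le_of_surjective (aeval (R := B)
      (⟨monomial n a, Algebra.subset_adjoin (by simp)⟩ :
        Algebra.adjoin B (insert (monomial n a) ((∅ : Finset B[X]) : Set B[X])))).toRingHom ?_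
    rintro ⟨y, hy⟩
    have hy' := hy
    rw [Finset.coe_empty, LawfulSingleton.insert_empty_eq,
      Algebra.adjoin_singleton_eq_range_aeval] at hy'
    obtain ⟨p, rfl⟩ := hy'
    refine ⟨p, Subtype.ext ?_⟩
    exact (Subalgebra.aeval_coe _ _ _).symm
  | insert x T hx ih =>
    have ih := ih fun y hy => hT y (Finset.mem_insert_of_mem hy)
    refine le_trans ?_ ih
    obtain ⟨k, b, rfl⟩ := hT _ (Finset.mem_insert_self _ _)
    rw [Finset.coe_insert, Set.insert_comm]
    set T' : Set B[X] := insert (monomial n a) (T : Set B[X])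
    have hfin : T'.Finite := (Finset.finite_toSet T).insert _
    have hnoeth : IsNoetherianRing (Algebra.adjoin B T') := by
      have hfg : (Algebra.adjoin B T').FG := Subalgebra.fg_def.mpr ⟨T', hfin, rfl⟩
      exact isNoetherianRing_of_fg hfg
    let y : Algebra.adjoin B T' := ⟨monomial n a, Algebra.subset_adjoin (Set.mem_insert _ _)⟩
    -- The new monomial `b t^k` is algebraic over the algebra containing `y = a t^n`: both `a^k (b
    -- t^k)^n` and `b^n y^k` equal `a^k b^n t^(kn)`. Its leading coefficient `a^k` is nonzero.
    let p : (Algebra.adjoin B T')[X] :=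
      C (algebraMap B _ (a ^ k)) * X ^ n - C (algebraMap B _ (b ^ n) * y ^ k)
    refine ringKrullDim_le_of_surjective_polynomial (Algebra.adjoinInsertEval T' (monomial k b))
      (Algebra.adjoinInsertEval_surjective _ _) (p := p) ?_ ?_
    · intro hp
      have h := congrArg (fun q => ((q.coeff n : Algebra.adjoin B T') : B[X])) hp
      simp only [p, coeff_sub, coeff_C_mul, coeff_X_pow, if_true, coeff_C, hn.ne', if_false,
        mul_one, sub_zero, coeff_zero] at h
      have h2 : (C (a ^ k) : B[X]) = 0 := h
      exact pow_ne_zero k ha (C_eq_zero.mp h2)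
    · simp only [p, map_sub, map_mul, map_pow, Algebra.adjoinInsertEval_C,
        Algebra.adjoinInsertEval_X]
      refine Subtype.ext ?_
      change C a ^ k * (monomial k b) ^ n - C b ^ n * (monomial n a) ^ k = 0
      rw [← C_pow, ← C_pow]
      rw [monomial_pow, monomial_pow, C_mul_monomial, C_mul_monomial, mul_comm k n,
        mul_comm (a ^ k), sub_self]

/-- Each chain of primes over `K` lies over its own smallest member. -/
theorem ringKrullDim_quotient_le_of_forall_prime {A : Type*} [CommRing A] {K : Ideal A}
    {D : WithBot ℕ∞}
    (h : ∀ P : Ideal A, P.IsPrime → K ≤ P → ringKrullDim (A ⧸ P) ≤ D) :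
    ringKrullDim (A ⧸ K) ≤ D := by
  rw [ringKrullDim_quotient]
  refine iSup_le fun p => ?_
  refine le_trans ?_ (h p.head.1.asIdeal p.head.1.2 p.head.2)
  rw [ringKrullDim_quotient]
  let q : LTSeries (PrimeSpectrum.zeroLocus (p.head.1.asIdeal : Set A)) :=
    { length := p.length
      toFun := fun i => ⟨(p i).1, LTSeries.head_le p i⟩
      step := fun i => p.step i }
  exact Order.LTSeries.length_le_krullDim q

theorem exists_eq_natCast_of_le {x : WithBot ℕ∞} {N : ℕ} (h0 : 0 ≤ x) (hN : x ≤ N) :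
    ∃ d : ℕ, x = d := by
  induction x with
  | bot => simp at h0
  | coe x =>
    have h : x ≤ (N : ℕ∞) := WithBot.coe_le_coe.mp hN
    obtain ⟨d, rfl⟩ := ENat.ne_top_iff_exists.mp (ne_top_of_le_ne_top (ENat.natCast_ne_top N) h)
    exact ⟨d, rfl⟩

theorem exists_ringKrullDim_eq_natCast (R : Type*) [CommRing R] [IsLocalRing R]
    [IsNoetherianRing R] : ∃ D : ℕ, ringKrullDim R = D := by
  obtain ⟨h1, h2⟩ := finiteRingKrullDim_iff_ne_bot_and_top.mp
    (inferInstance : FiniteRingKrullDim R)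
  obtain ⟨x, hx⟩ := WithBot.ne_bot_iff_exists.mp h1
  rw [← hx] at h2 ⊢
  obtain ⟨d, rfl⟩ := ENat.ne_top_iff_exists.mp (fun h : x = ⊤ => h2 (by rw [h]; rfl))
  exact ⟨d, rfl⟩

end Dimension

/-! ### Bounding the dimension of the symbolic fiber cone. -/

namespace Ideal

variable {R : Type*} [CommRing R] (I : Ideal R)

theorem mem_symbolicPower_of_mul_mem {x : R} (hx : ∀ p ∈ I.minimalPrimes, x ∉ p) {n : ℕ} {r : R}
    (h : x * r ∈ I.symbolicPower n) : r ∈ I.symbolicPower n := by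
  rw [mem_symbolicPower] at h ⊢
  intro p hp
  have h1 := h p hp
  have hu : IsUnit (algebraMap R (Localization.AtPrime p.asIdeal) x) :=
    IsLocalization.map_units (M := p.asIdeal.primeCompl) _ ⟨x, hx _ hp⟩
  rw [map_mul] at h1
  exact (unit_mul_mem_iff_mem _ hu).mp h1

section

variable {B : Type*} [CommRing B]

/-- The map from the symbolic Rees algebra to `B[t]` induced by a ring homomorphism `R → B`. -/
noncomputable def symbolicReesMap (φ : R →+* B) : I.symbolicReesAlgebra →+* B[X] :=
  (mapRingHom φ).comp I.symbolicReesAlgebra.val.toRingHom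

theorem symbolicReesMap_apply (φ : R →+* B) (f : I.symbolicReesAlgebra) :
    I.symbolicReesMap φ f = (f : R[X]).map φ := rfl

theorem symbolicReesMap_of_mem (φ : R →+* B) {n : ℕ} {f : I.symbolicReesAlgebra}
    (hf : f ∈ I.symbolicReesPiece n) :
    I.symbolicReesMap φ f = monomial n (φ ((f : R[X]).coeff n)) := by
  have h1 : (f : R[X]) = monomial n ((f : R[X]).coeff n) :=
    congrArg Subtype.val (I.eq_symbolicReesMonomial hf)
  rw [symbolicReesMap_apply, h1, map_monomial, coeff_monomial, if_pos rfl]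

/-- The image in `B[t]` is generated over `B` by the monomials coming from homogeneous generators.
Adding the image of `f` changes nothing and supplies the nonconstant monomial. -/
theorem ringKrullDim_quotient_ker_symbolicReesMap_le [IsDomain B] [IsNoetherianRing B]
    (hnoeth : IsNoetherianRing I.symbolicReesAlgebra) (φ : R →+* B)
    (hφ : Function.Surjective φ) {n : ℕ} (hn : 0 < n) {f : I.symbolicReesAlgebra}
    (hf : f ∈ I.symbolicReesPiece n) (hf0 : I.symbolicReesMap φ f ≠ 0) :
    ringKrullDim (I.symbolicReesAlgebra ⧸ RingHom.ker (I.symbolicReesMap φ)) ≤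
      ringKrullDim B + 1 := by
  classical
  obtain ⟨s, d, hd, hs⟩ := GradedAlgebra.exists_finset_adjoin_eq_top I.symbolicReesPiece
    (fun a ha => ⟨_, (I.eq_algebraMap_of_mem_symbolicReesPiece_zero ha).symm⟩)
  set T : Finset B[X] := s.image (I.symbolicReesMap φ)
  set a := φ ((f : R[X]).coeff n)
  have hfa : I.symbolicReesMap φ f = monomial n a := I.symbolicReesMap_of_mem φ hf
  have ha : a ≠ 0 := by
    intro h
    rw [hfa, h, monomial_zero_right] at hf0
    exact hf0 rfl
  have hT : ∀ x ∈ T, ∃ k b, x = monomial k b := by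
    intro x hx
    obtain ⟨g, hg, rfl⟩ := Finset.mem_image.mp hx
    exact ⟨_, _, I.symbolicReesMap_of_mem φ (hd g hg).2⟩
  have hrange : (I.symbolicReesMap φ).range =
      (Algebra.adjoin B (insert (monomial n a) (T : Set B[X]))).toSubring := by
    apply le_antisymm
    · rintro _ ⟨g, rfl⟩
      have hg : g ∈ Algebra.adjoin R (s : Set I.symbolicReesAlgebra) := by rw [hs]; trivial
      change I.symbolicReesMap φ g ∈ Algebra.adjoin B _
      induction hg using Algebra.adjoin_induction with
      | mem z hz =>
        exact Algebra.subset_adjoin (Set.mem_insert_of_mem _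
          (Finset.mem_coe.mpr (Finset.mem_image_of_mem _ hz)))
      | algebraMap r =>
        have : I.symbolicReesMap φ (algebraMap R _ r) = algebraMap B B[X] (φ r) := by
          change (C r : R[X]).map φ = C (φ r)
          rw [map_C]
        rw [this]
        exact Subalgebra.algebraMap_mem _ _
      | add u v _ _ hu hv => rw [map_add]; exact add_mem hu hv
      | mul u v _ _ hu hv => rw [map_mul]; exact mul_mem hu hv
    · intro y hy
      have hy : y ∈ Algebra.adjoin B (insert (monomial n a) (T : Set B[X])) := hy
      induction hy using Algebra.adjoin_induction with
      | mem z hz =>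
        rcases hz with rfl | hz
        · exact ⟨f, hfa⟩
        · obtain ⟨g, -, rfl⟩ := Finset.mem_image.mp (Finset.mem_coe.mp hz)
          exact ⟨g, rfl⟩
      | algebraMap b =>
        obtain ⟨r, rfl⟩ := hφ b
        refine ⟨algebraMap R _ r, ?_⟩
        change (C r : R[X]).map φ = C (φ r)
        rw [map_C]
      | add u v _ _ hu hv => exact add_mem (hu ‹_›) (hv ‹_›)
      | mul u v _ _ hu hv => exact mul_mem (hu ‹_›) (hv ‹_›)
  rw [ringKrullDim_eq_of_ringEquiv (RingHom.quotientKerEquivRange (I.symbolicReesMap φ)),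
    ringKrullDim_eq_of_ringEquiv (RingEquiv.subringCongr hrange)]
  exact ringKrullDim_adjoin_monomials_le hn ha T hT

end

variable [IsLocalRing R]

theorem mem_maximalIdeal_of_mem_symbolicPower (hI : I ≠ ⊤) {n : ℕ} (hn : 0 < n) {a : R}
    (ha : a ∈ I.symbolicPower n) : a ∈ IsLocalRing.maximalIdeal R := by
  have h1 : I.radical ≤ IsLocalRing.maximalIdeal R :=
    (IsLocalRing.maximalIdeal.isMaximal R).isPrime.radical_le_iff.mpr
      (IsLocalRing.le_maximalIdeal hI)
  exact h1 (I.symbolicPower_le_radical hn ha)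

/-- The symbolic fiber cone has dimension at most that of any quotient of `R` over which it can
be computed. -/
theorem ringKrullDim_quotient_symbolicFiberIdeal_le {S : Type*} [CommRing S] [Nontrivial S]
    [IsNoetherianRing S] (hI : I ≠ ⊤) (hnoeth : IsNoetherianRing I.symbolicReesAlgebra)
    (ψ : R →+* S) (hψ : Function.Surjective ψ)
    (hker : RingHom.ker (I.symbolicReesMap ψ) ≤ I.symbolicFiberIdeal) :
    ringKrullDim (I.symbolicReesAlgebra ⧸ I.symbolicFiberIdeal) ≤ ringKrullDim S := by
  refine ringKrullDim_quotient_le_of_forall_prime fun P hP hle => ?_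
  have hfin : (minimalPrimes S).Finite := minimalPrimes.finite_of_isNoetherianRing S
  -- An element vanishing modulo every minimal prime of `S` has nilpotent image in `S[t]`, so a
  -- power of it lies in `P`. Hence `P` contains one of these kernels.
  have hinf : hfin.toFinset.inf (fun p : Ideal S =>
      RingHom.ker (I.symbolicReesMap ((Ideal.Quotient.mk p).comp ψ))) ≤ P := by
    intro f hf
    have hf' : ∀ p ∈ minimalPrimes S, ∀ k, ψ ((f : R[X]).coeff k) ∈ p := by
      intro p hp k
      have h1 := (Submodule.mem_finsetInf.mp hf) p (hfin.mem_toFinset.mpr hp)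
      rw [RingHom.mem_ker, symbolicReesMap_apply] at h1
      have h2 := congrArg (fun g => coeff g k) h1
      simp only [coeff_map, coeff_zero] at h2
      exact Ideal.Quotient.eq_zero_iff_mem.mp h2
    have hnil : IsNilpotent (I.symbolicReesMap ψ f) := by
      rw [Polynomial.isNilpotent_iff]
      intro k
      rw [symbolicReesMap_apply, coeff_map, ← mem_nilradical, nilradical, ← sInf_minimalPrimes]
      exact Submodule.mem_sInf.mpr fun p hp => hf' p hp k
    obtain ⟨k, hk⟩ := hnil
    refine hP.mem_of_pow_mem k (hle (hker ?_))
    rw [RingHom.mem_ker, map_pow, hk]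
  obtain ⟨p, hp, hpP⟩ := (hP.inf_le').mp hinf
  have hpprime : p.IsPrime := (hfin.mem_toFinset.mp hp).1.1
  set φ := (Ideal.Quotient.mk p).comp ψ
  -- In the first case `P` is maximal and its quotient has dimension zero.
  by_cases hirr : (HomogeneousIdeal.irrelevant I.symbolicReesPiece).toIdeal ≤ P
  · have hM := I.symbolicReesMaximalIdeal_le hle hirr
    have hmax : P.IsMaximal := by
      have : I.symbolicReesMaximalIdeal = P :=
        IsMaximal.eq_of_le inferInstance hP.ne_top hM
      rw [← this]
      infer_instance
    rw [ringKrullDim_eq_zero_of_isField ((Ideal.Quotient.maximal_ideal_iff_isField_quotient P).mp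
      hmax)]
    exact ringKrullDim_nonneg_of_nontrivial
  · obtain ⟨n, hn, f, hf, hfP⟩ :=
      GradedAlgebra.exists_homogeneous_notMem_of_not_irrelevant_le _ hirr
    have hf0 : I.symbolicReesMap φ f ≠ 0 := fun h => hfP (hpP h)
    -- This strictness cancels the `+ 1` in the monomial algebra bound. The coefficient of `f` lies
    -- in `m`, so as a scalar it is in `P`; were it in the kernel, `f` would be too.
    have hlt : RingHom.ker (I.symbolicReesMap φ) < P := by
      refine lt_of_le_of_ne hpP fun heq => hf0 ?_
      have h1 : algebraMap R I.symbolicReesAlgebra ((f : R[X]).coeff n) ∈ P :=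
        hle (mem_map_of_mem _ (I.mem_maximalIdeal_of_mem_symbolicPower hI hn (f.2 n)))
      rw [← heq, RingHom.mem_ker] at h1
      have h2 : (C (φ ((f : R[X]).coeff n)) : (S ⧸ p)[X]) = 0 := by
        rw [← h1]
        change _ = (C _ : R[X]).map φ
        rw [map_C]
        rfl
      rw [I.symbolicReesMap_of_mem φ hf, C_eq_zero.mp h2, monomial_zero_right]
    have h1 := ringKrullDim_quotient_succ_le_of_forall_exists_lt hlt.le
      fun Q hQ hPQ => ⟨_, RingHom.ker_isPrime (I.symbolicReesMap φ), le_rfl, hlt.trans_le hPQ⟩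
    have h2 := I.ringKrullDim_quotient_ker_symbolicReesMap_le hnoeth φ
      (Ideal.Quotient.mk_surjective.comp hψ) hn hf hf0
    have h3 := ringKrullDim_quotient_le p
    exact ENat.WithBot.add_le_add_one_right_iff.mp
      (h1.trans (h2.trans (ENat.WithBot.add_le_add_one_right_iff.mpr h3)))

/-- Being a unit at every minimal prime of `I`, the element `x` can be cancelled in symbolic powers.
So coefficients divisible by `x` are `x` times elements of the same symbolic power. -/
theorem ker_symbolicReesMap_mk_span_le {x : R} (hxm : x ∈ IsLocalRing.maximalIdeal R)
    (hx : ∀ p ∈ I.minimalPrimes, x ∉ p) :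
    RingHom.ker (I.symbolicReesMap (Ideal.Quotient.mk (span {x}))) ≤ I.symbolicFiberIdeal := by
  classical
  intro f hf
  rw [RingHom.mem_ker, symbolicReesMap_apply] at hf
  rw [← DirectSum.sum_support_decompose I.symbolicReesPiece f]
  refine Ideal.sum_mem _ fun k _ => ?_
  have h1 : (f : R[X]).coeff k ∈ span {x} := by
    have := congrArg (fun g => coeff g k) hf
    simp only [coeff_map, coeff_zero] at this
    exact Ideal.Quotient.eq_zero_iff_mem.mp this
  obtain ⟨r, hr⟩ := mem_span_singleton'.mp h1
  rw [mul_comm] at hr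
  have hmem : r ∈ I.symbolicPower k := I.mem_symbolicPower_of_mul_mem hx (hr ▸ f.2 k)
  have h2 : (DirectSum.decompose I.symbolicReesPiece f k : I.symbolicReesAlgebra) =
      algebraMap R _ x * I.symbolicReesMonomial k ⟨r, hmem⟩ := by
    ext1
    rw [decompose_symbolicReesPiece, coe_symbolicReesComponent, ← hr]
    change _ = C x * monomial k r
    rw [C_mul_monomial]
  rw [h2]
  exact mul_mem_right _ _ (mem_map_of_mem _ hxm)

variable [IsNoetherianRing R]

theorem ringKrullDim_quotient_symbolicFiberIdeal_le_self (hI : I ≠ ⊤)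
    (hnoeth : IsNoetherianRing I.symbolicReesAlgebra) :
    ringKrullDim (I.symbolicReesAlgebra ⧸ I.symbolicFiberIdeal) ≤ ringKrullDim R := by
  refine I.ringKrullDim_quotient_symbolicFiberIdeal_le hI hnoeth (RingHom.id R)
    Function.surjective_id fun f hf => ?_
  rw [RingHom.mem_ker, symbolicReesMap_apply, Polynomial.map_id] at hf
  rw [show f = 0 from Subtype.ext hf]
  exact zero_mem _

/-- Avoiding the minimal primes of `I` allows cancelling `x` in symbolic powers; avoiding those of
`R` makes the dimension drop modulo `x`. -/
theorem exists_mem_maximalIdeal_forall_notMem_minimalPrimes (hI : I ≠ ⊤)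
    (hdim : ¬ ringKrullDim (R ⧸ I) ≤ 0) :
    ∃ x ∈ IsLocalRing.maximalIdeal R, (∀ p ∈ I.minimalPrimes, x ∉ p) ∧
      ∀ p ∈ minimalPrimes R, x ∉ p := by
  have h1 : IsLocalRing.maximalIdeal R ∉ I.minimalPrimes := by
    intro h
    refine hdim ?_
    have : Ring.KrullDimLE 0 (R ⧸ I) := by
      rw [krullDimLE_zero_quotient_iff_forall_minimalPrimes_isMaximal]
      intro J hJ
      have := h.2 hJ.1 (IsLocalRing.le_maximalIdeal hJ.1.1.ne_top)
      rw [le_antisymm (IsLocalRing.le_maximalIdeal hJ.1.1.ne_top) this]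
      infer_instance
    exact_mod_cast Ring.krullDimLE_iff.mp this
  have h2 : IsLocalRing.maximalIdeal R ∉ minimalPrimes R := fun h =>
    h1 ⟨⟨h.1.1, IsLocalRing.le_maximalIdeal hI⟩, fun J hJ hle => h.2 ⟨hJ.1, bot_le⟩ hle⟩
  have hfin : (I.minimalPrimes ∪ minimalPrimes R).Finite :=
    (finite_minimalPrimes_of_isNoetherianRing R I).union
      (minimalPrimes.finite_of_isNoetherianRing R)
  have hprime : ∀ p ∈ I.minimalPrimes ∪ minimalPrimes R, p.IsPrime ∧
      p ≠ IsLocalRing.maximalIdeal R := by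
    rintro p (hp | hp)
    · exact ⟨hp.1.1, fun h => h1 (h ▸ hp)⟩
    · exact ⟨hp.1.1, fun h => h2 (h ▸ hp)⟩
  have hnot : ¬ ((IsLocalRing.maximalIdeal R : Set R) ⊆
      ⋃ p ∈ (hfin.toFinset : Set (Ideal R)), (p : Set R)) := by
    intro h
    rw [subset_union_prime ⊥ ⊥ (fun p hp _ _ => (hprime p (hfin.mem_toFinset.mp hp)).1)] at h
    obtain ⟨p, hp, hle⟩ := h
    have hp' := hprime p (hfin.mem_toFinset.mp hp)
    exact hp'.2 (le_antisymm (IsLocalRing.le_maximalIdeal hp'.1.ne_top) hle)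
  obtain ⟨x, hxm, hx⟩ := Set.not_subset.mp hnot
  simp only [Set.mem_iUnion, not_exists] at hx
  exact ⟨x, hxm, fun p hp => hx p (by simpa using Or.inl hp),
    fun p hp => hx p (by simpa using Or.inr hp)⟩

theorem ringKrullDim_quotient_symbolicFiberIdeal_succ_le (hI : I ≠ ⊤)
    (hdim : ¬ ringKrullDim (R ⧸ I) ≤ 0) (hnoeth : IsNoetherianRing I.symbolicReesAlgebra) :
    ringKrullDim (I.symbolicReesAlgebra ⧸ I.symbolicFiberIdeal) + 1 ≤ ringKrullDim R := by
  obtain ⟨x, hxm, hxI, hxR⟩ := I.exists_mem_maximalIdeal_forall_notMem_minimalPrimes hI hdim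
  have hne : span {x} ≠ ⊤ := by
    rw [Ne, span_singleton_eq_top]
    exact (IsLocalRing.mem_maximalIdeal x).mp hxm
  have : Nontrivial (R ⧸ span {x}) := Ideal.Quotient.nontrivial_iff.mpr hne
  have h1 := I.ringKrullDim_quotient_symbolicFiberIdeal_le hI hnoeth
    (Ideal.Quotient.mk (span {x})) Ideal.Quotient.mk_surjective
    (I.ker_symbolicReesMap_mk_span_le hxm hxI)
  have h2 : ringKrullDim (R ⧸ span {x}) + 1 ≤ ringKrullDim (R ⧸ (⊥ : Ideal R)) := by
    have := ringKrullDim_quotient_sup_span_succ_le (K := (⊥ : Ideal R)) (g := x) hxR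
    rwa [bot_sup_eq] at this
  rw [ringKrullDim_eq_of_ringEquiv (RingEquiv.quotientBot R)] at h2
  exact (ENat.WithBot.add_le_add_one_right_iff.mpr h1).trans h2

/-- The Rees algebra is a finitely generated `R`-algebra and `R` has finite dimension. -/
theorem exists_ringKrullDim_quotient_symbolicFiberIdeal_eq
    (hnoeth : IsNoetherianRing I.symbolicReesAlgebra) :
    ∃ d : ℕ, ringKrullDim (I.symbolicReesAlgebra ⧸ I.symbolicFiberIdeal) = d := by
  obtain ⟨s, d, -, hs⟩ := GradedAlgebra.exists_finset_adjoin_eq_top I.symbolicReesPiece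
    (fun a ha => ⟨_, (I.eq_algebraMap_of_mem_symbolicReesPiece_zero ha).symm⟩)
  have hft : Algebra.FiniteType R I.symbolicReesAlgebra := ⟨⟨s, hs⟩⟩
  obtain ⟨n, f, hf⟩ := Algebra.FiniteType.iff_quotient_mvPolynomial''.mp hft
  have h1 : ringKrullDim (I.symbolicReesAlgebra ⧸ I.symbolicFiberIdeal) ≤ ringKrullDim R + n := by
    refine (ringKrullDim_quotient_le _).trans ((ringKrullDim_le_of_surjective f.toRingHom hf).trans
      (le_of_eq ?_))
    rw [MvPolynomial.ringKrullDim_of_isNoetherianRing, Nat.card_fin]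
  have hne : I.symbolicFiberIdeal ≠ ⊤ := by
    refine ne_top_of_le_ne_top (b := I.symbolicReesMaximalIdeal) IsPrime.ne_top' ?_
    rw [map_le_iff_le_comap]
    intro r hr
    change (C r : R[X]).coeff 0 ∈ IsLocalRing.maximalIdeal R
    rwa [coeff_C_zero]
  have : Nontrivial (I.symbolicReesAlgebra ⧸ I.symbolicFiberIdeal) :=
    Ideal.Quotient.nontrivial_iff.mpr hne
  obtain ⟨D, hD⟩ := exists_ringKrullDim_eq_natCast R
  rw [hD] at h1
  exact exists_eq_natCast_of_le (N := D + n) ringKrullDim_nonneg_of_nontrivial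
    (by exact_mod_cast h1)

end Ideal

/-! ### The spread as the dimension of the fiber cone, and conclusion. -/

theorem ringKrullDimEReal_of_eq_natCast {R : Type*} [CommRing R] {D : ℕ}
    (h : ringKrullDim R = D) : ringKrullDimEReal R = D := by
  rw [ringKrullDimEReal, h]
  change (((D : ℕ∞) : ENNReal) : EReal) = D
  rw [ENat.toENNReal_coe]
  exact_mod_cast rfl

theorem ringKrullDimEReal_of_eq_bot {R : Type*} [CommRing R]
    (h : ringKrullDim R = ⊥) : ringKrullDimEReal R = ⊥ := by
  rw [ringKrullDimEReal, h]
  rfl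

theorem Ideal.symbolicAnalyticSpread_eq {R : Type*} [CommRing R] [IsLocalRing R]
    [IsNoetherianRing R] (I : Ideal R) (hnoeth : IsNoetherianRing I.symbolicReesAlgebra) {d : ℕ}
    (hd : ringKrullDim (I.symbolicReesAlgebra ⧸ I.symbolicFiberIdeal) = d) :
    I.symbolicAnalyticSpread = ((d : ℝ) : EReal) := by
  refine le_antisymm (sInf_le ⟨_, I.natCast_mem_growthExponents hnoeth hd.le, rfl⟩) (le_sInf ?_)
  rintro _ ⟨t, ht, rfl⟩
  exact EReal.coe_le_coe_iff.mpr (I.natCast_le_of_mem_growthExponents hd.ge ht)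

theorem Ideal.natCast_le_max_of_ringKrullDim_eq {R : Type*} [CommRing R] [IsLocalRing R]
    [IsNoetherianRing R] (I : Ideal R) (hnoeth : IsNoetherianRing I.symbolicReesAlgebra) {d : ℕ}
    (hd : ringKrullDim (I.symbolicReesAlgebra ⧸ I.symbolicFiberIdeal) = d) :
    ((d : ℝ) : EReal) ≤
      max (ringKrullDimEReal R - ringKrullDimEReal (R ⧸ I)) (ringKrullDimEReal R - 1) := by
  obtain ⟨D, hD⟩ := exists_ringKrullDim_eq_natCast R
  rw [ringKrullDimEReal_of_eq_natCast hD]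
  -- For the unit ideal the first difference is `D - ⊥ = ⊤`, so the bound is trivial.
  by_cases hI : I = ⊤
  · have hsub : Subsingleton (R ⧸ I) := Ideal.Quotient.subsingleton_iff.mpr hI
    rw [ringKrullDimEReal_of_eq_bot ringKrullDim_eq_bot_of_subsingleton]
    have : ((D : ℕ) : EReal) - ⊥ = ⊤ := EReal.coe_sub_bot D
    rw [this]
    simp
  have hnt : Nontrivial (R ⧸ I) := Ideal.Quotient.nontrivial_iff.mpr hI
  -- Dimension zero uses the first entry of the maximum, positive dimension the second.
  by_cases hdim : ringKrullDim (R ⧸ I) ≤ 0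
  · have h0 : ringKrullDim (R ⧸ I) = (0 : ℕ) := le_antisymm hdim ringKrullDim_nonneg_of_nontrivial
    rw [ringKrullDimEReal_of_eq_natCast h0]
    have h1 := I.ringKrullDim_quotient_symbolicFiberIdeal_le_self hI hnoeth
    rw [hd, hD] at h1
    have h2 : d ≤ D := by exact_mod_cast h1
    refine le_max_of_le_left ?_
    simp only [Nat.cast_zero, sub_zero]
    exact_mod_cast h2
  · have h1 := I.ringKrullDim_quotient_symbolicFiberIdeal_succ_le hI hdim hnoeth
    rw [hd, hD] at h1
    have h2 : d + 1 ≤ D := by exact_mod_cast h1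
    refine le_max_of_le_right ?_
    have h3 : ((D : ℕ) : EReal) - 1 = (((D : ℝ) - 1 : ℝ) : EReal) := by
      rw [EReal.coe_sub]; rfl
    rw [h3, EReal.coe_le_coe_iff, le_sub_iff_add_le]
    exact_mod_cast h2

theorem proposition2p3 {R : Type*} [CommRing R] [IsLocalRing R] [IsNoetherianRing R]
    (I : Ideal R)
    (hdepth : min (ringKrullDim (R ⧸ I)) 1 ≤ (IsLocalRing.ringDepth R : WithBot ℕ∞))
    (hnoeth : IsNoetherianRing I.symbolicReesAlgebra) :
    (∃ t ∈ Ideal.growthExponents I.symbolicPower, I.symbolicAnalyticSpread = (t : EReal)) ∧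
    (I.arithmeticRank : EReal) ≤ I.symbolicAnalyticSpread ∧
    I.symbolicAnalyticSpread ≤
      max (ringKrullDimEReal R - ringKrullDimEReal (R ⧸ I)) (ringKrullDimEReal R - 1) := by
  obtain ⟨d, hd⟩ := I.exists_ringKrullDim_quotient_symbolicFiberIdeal_eq hnoeth
  rw [I.symbolicAnalyticSpread_eq hnoeth hd]
  refine ⟨⟨d, I.natCast_mem_growthExponents hnoeth hd.le, rfl⟩, ?_,
    I.natCast_le_max_of_ringKrullDim_eq hnoeth hd⟩
  exact_mod_cast I.arithmeticRank_le_of_ringKrullDim_le hnoeth hd.le
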